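/- Let $U=(U_y)_{y\in\mathbb Z}$ and $V=(V_x)_{x\in\mathbb Z}$ be sequences of random variables with values in $\{-1,1\}$, all of them independent and symmetrically distributed, on a probability space $(\Omega,\mathcal A,\mathbb P)$. Let $\omega$ be the random directed graph on $\mathbb Z^2$ whose edges are the pairs $\big((x,y),(x+U_y,\,y+V_x)\big)$, $(x,y)\in\mathbb Z^2$. Call a vertex $v$ a trap vertex if there is a vertex $w$ such that both $(v,w)$ and $(w,v)$ are edges of $\omega$, and write $a\to b$ if there is a directed path $a=a_0,a_1,\dots,a_n=b$ in $\omega$, $n\ge 0$, such that none of $a_1,\dots,a_{n-1}$ is a trap vertex. Let $o\in\mathbb Z^2$. Let $C(o)$ be the connected component of $o$ in $\omega$ (edge directions being disregarded). Write $\operatorname{diam}$ for the Euclidean diameter and $|\cdot|$ for the cardinality, both with values in $[0,\infty]$. Then there exist absolute constants $c_1,C_1,c_2,C_2>0$ (depending neither on $o$ nor on the probability space) such that, for all integers $n\ge 0$, $$C_1e^{-c_1n^{1/3}}\le \mathbb P(\operatorname{diam} C(o)>n)\le C_2e^{-c_2n^{1/4}}$$ and $$C_1e^{-c_1n^{1/3}}\le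 \mathbb P(|C(o)|>n)\le C_2e^{-c_2n^{1/8}}.$$ In particular, $\mathbb E[\operatorname{diam} C(o)]<\infty$ and $\mathbb E[|C(o)|]<\infty$. Moreover, all of this holds, with the same constants, if $C(o)$ is replaced by the set $\{u\in\mathbb Z^2 : u\to o \text{ or } o\to u\}$. -/

import Mathlib

open MeasureTheory ProbabilityTheory
open scoped ENNReal

/-- From the vertex `(x, y)` the deterministic walk moves to `(x + U y, y + V x)`, where `U y` is the
orientation of the horizontal line at height `y` and `V x` that of the vertical line at abscissa `x`. -/
def manhattanStep (U V : ℤ → ℤ) (v : ℤ × ℤ) : ℤ × ℤ := (v.1 + U v.2, v.2 + V v.1)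

/-- The directed edges of the random graph: exactly one outgoing edge `v → manhattanStep U V v` at
each vertex `v` of the plane lattice. -/
def ManhattanEdge (U V : ℤ → ℤ) (a b : ℤ × ℤ) : Prop := b = manhattanStep U V a

/-- The undirected graph underlying the random graph. -/
def manhattanGraph (U V : ℤ → ℤ) : SimpleGraph (ℤ × ℤ) := SimpleGraph.fromRel (ManhattanEdge U V)

/-- The (vertex set of the) connected component of `o` in the random graph. -/
def manhattanComponent (U V : ℤ → ℤ) (o : ℤ × ℤ) : Set (ℤ × ℤ) :=
  ((manhattanGraph U V).connectedComponentMk o).supp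

/-- `v` is an inward trap vertex: it is an endpoint of a pair of opposite edges of the random graph. -/
def IsTrapVertex (U V : ℤ → ℤ) (v : ℤ × ℤ) : Prop :=
  ∃ w, ManhattanEdge U V v w ∧ ManhattanEdge U V w v

/-- `a → b`: there is a directed path `a = a₀, a₁, …, aₙ = b` (with `n ≥ 0`) in the random graph such
that none of `a₁, …, aₙ₋₁` is an inward trap vertex. -/
def Leads (U V : ℤ → ℤ) (a b : ℤ × ℤ) : Prop :=
  ∃ (n : ℕ) (p : ℕ → ℤ × ℤ), p 0 = a ∧ p n = b ∧
    (∀ k < n, ManhattanEdge U V (p k) (p (k + 1))) ∧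
    ∀ k, 0 < k → k < n → ¬ IsTrapVertex U V (p k)

/-- The set of all `u` with `u → o` or `o → u`. -/
def manhattanLineage (U V : ℤ → ℤ) (o : ℤ × ℤ) : Set (ℤ × ℤ) :=
  {u | Leads U V u o ∨ Leads U V o u}

/-- The Euclidean diameter, with values in `[0, ∞]`, of a set of vertices of the plane lattice. -/
noncomputable def latticeDiam (S : Set (ℤ × ℤ)) : ℝ≥0∞ :=
  Metric.ediam ((fun v : ℤ × ℤ => (!₂[(v.1 : ℝ), (v.2 : ℝ)] : EuclideanSpace ℝ (Fin 2))) '' S)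

/-- The number of elements, in `[0, ∞]`, of a set of vertices of the plane lattice. -/
noncomputable def latticeCard (S : Set (ℤ × ℤ)) : ℝ≥0∞ := (S.encard : ℝ≥0∞)

/-- `U` and `V` are two families, all of whose variables together are independent, of random
variables with the symmetric distribution on `{-1, 1}`. -/
structure IsManhattanEnvironment {Ω : Type*} [MeasurableSpace Ω] (P : Measure Ω)
    (U V : ℤ → Ω → ℤ) : Prop where
  measurable_horizontal : ∀ y, Measurable (U y)
  measurable_vertical : ∀ x, Measurable (V x)
  horizontal_values : ∀ y ω, U y ω = -1 ∨ U y ω = 1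
  vertical_values : ∀ x ω, V x ω = -1 ∨ V x ω = 1
  horizontal_symm : ∀ y, P {ω | U y ω = -1} = P {ω | U y ω = 1}
  vertical_symm : ∀ x, P {ω | V x ω = -1} = P {ω | V x ω = 1}
  indep : iIndepFun (Sum.elim U V) P

/-- The tail bounds, with constants `c₁ C₁ c₂ C₂`, for the diameter and for the cardinality of a
random set `C` of vertices, together with the integrability of both. -/
def HasSizeTails {Ω : Type*} [MeasurableSpace Ω] (P : Measure Ω) (C : Ω → Set (ℤ × ℤ))
    (c₁ C₁ c₂ C₂ : ℝ) : Prop :=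
  (∀ n : ℕ,
    C₁ * Real.exp (-c₁ * (n : ℝ) ^ (1 / 3 : ℝ)) ≤ P.real {ω | (n : ℝ≥0∞) < latticeDiam (C ω)} ∧
    P.real {ω | (n : ℝ≥0∞) < latticeDiam (C ω)} ≤ C₂ * Real.exp (-c₂ * (n : ℝ) ^ (1 / 4 : ℝ))) ∧
  (∀ n : ℕ,
    C₁ * Real.exp (-c₁ * (n : ℝ) ^ (1 / 3 : ℝ)) ≤ P.real {ω | (n : ℝ≥0∞) < latticeCard (C ω)} ∧
    P.real {ω | (n : ℝ≥0∞) < latticeCard (C ω)} ≤ C₂ * Real.exp (-c₂ * (n : ℝ) ^ (1 / 8 : ℝ))) ∧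
  ∫⁻ ω, latticeDiam (C ω) ∂P < ∞ ∧
  ∫⁻ ω, latticeCard (C ω) ∂P < ∞

/-! Each vertex has exactly one outgoing edge, so the graph is made of deterministic walks, and
everything reduces to how far one walk can travel.

Upper bound. When the walk from the origin first hits column `k`, at height `y`, it has read no
vertical orientation beyond column `k - 1`, so `V k` is still a fair coin. If `U y = 1`, the walk
moves on at once to column `k + 1`, at height `y + V k`. If `U y = -1`, it turns back, and when `V k
= -V (k - 1)` it retraces its last edge and oscillates forever. The heights at first hits thus
behave like a simple random walk that is killed with probability at least 1/2 at each height where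
`U = -1`. If all gaps between such heights are at most `W`, a quadratic weight on the gaps makes
survival decay like `(1 - 1/(5W²))^n` (`hitWeight_add_le`, `lintegral_hitWeight_le`); a longer gap
costs about `n * 2^(-W)`. Taking `n = q^4` and `W = q` gives a stretched exponential in `n^(1/4)`.
Within a component all walks coalesce, so a vertex at distance `2r` from `o` forces its own walk or
that of `o` to travel distance `r`; a union bound over a box finishes (`coinMeasure_escapeSet_le`).
The cardinality is at most of the order of the squared radius, hence the exponent 1/8.

Lower bound. With probability `2^(-(2w+1))` all lines of a strip of half-width `w` point right; the
walk then moves right for as long as its height, a simple random walk, stays in the strip. The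
cosine eigenfunction bounds the confinement probability below by `cos(π/(2(w+1)))^N`, about
`exp(-cN/w²)`. The two costs balance at `w ≈ N^(1/3)`. The straight path meets no trap before its
end, so it lies in the lineage of `o`, which lies in the component: both random sets are treated by
one sandwich argument. -/

/-! ### Fair coins and the symmetries of their law -/

/-- The canonical space of environments: `true` stands for `1` and `false` for `-1`, the left summand
indexes the horizontal lines and the right summand the vertical lines. -/
abbrev CoinSpace := ℤ ⊕ ℤ → Bool

/-- The sign `1` or `-1` coded by a Boolean. -/
def boolSign (b : Bool) : ℤ := if b then 1 else -1

lemma boolSign_not (b : Bool) : boolSign (!b) = -boolSign b := by cases b <;> simp [boolSign]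

lemma boolSign_values (b : Bool) : boolSign b = 1 ∨ boolSign b = -1 := by
  cases b <;> simp [boolSign]

/-- Orientations of the horizontal lines. -/
def CoinSpace.horiz (e : CoinSpace) (y : ℤ) : ℤ := boolSign (e (Sum.inl y))

/-- Orientations of the vertical lines. -/
def CoinSpace.vert (e : CoinSpace) (x : ℤ) : ℤ := boolSign (e (Sum.inr x))

lemma CoinSpace.horiz_values (e : CoinSpace) (y : ℤ) : e.horiz y = 1 ∨ e.horiz y = -1 :=
  boolSign_values _

lemma CoinSpace.vert_values (e : CoinSpace) (x : ℤ) : e.vert x = 1 ∨ e.vert x = -1 :=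
  boolSign_values _

/-- The law of a fair coin. -/
noncomputable def fairCoin : Measure Bool := (PMF.uniformOfFintype Bool).toMeasure

instance : IsProbabilityMeasure fairCoin := by unfold fairCoin; infer_instance

lemma fairCoin_singleton (b : Bool) : fairCoin {b} = 2⁻¹ := by
  rw [fairCoin, PMF.toMeasure_apply_singleton _ _ (measurableSet_singleton b)]
  simp

lemma eq_fairCoin (ν : Measure Bool) (h : ∀ b, ν {b} = 2⁻¹) : ν = fairCoin :=
  Measure.ext_of_singleton fun b => by rw [h, fairCoin_singleton]

lemma fairCoin_map_xor (c : Bool) : fairCoin.map (xor c) = fairCoin := by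
  refine eq_fairCoin _ fun b => ?_
  rw [Measure.map_apply (by fun_prop) (measurableSet_singleton b), ← fairCoin_singleton (xor c b)]
  congr 1
  ext a
  cases a <;> cases b <;> cases c <;> simp

/-- The law of a family of independent fair coins. -/
noncomputable def coinMeasure : Measure CoinSpace := Measure.infinitePi fun _ => fairCoin

instance : IsProbabilityMeasure coinMeasure := by unfold coinMeasure; infer_instance

lemma coinMeasure_map_xor (c : ℤ ⊕ ℤ → Bool) :
    coinMeasure.map (fun e i => xor (c i) (e i)) = coinMeasure := by
  unfold coinMeasure
  have := Measure.infinitePi_map_pi (fun _ : ℤ ⊕ ℤ => fairCoin) (f := fun i => xor (c i))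
    (fun i => measurable_of_finite _)
  simpa only [fairCoin_map_xor] using this

lemma coinMeasure_map_comp (σ : Equiv.Perm (ℤ ⊕ ℤ)) :
    coinMeasure.map (fun e i => e (σ i)) = coinMeasure := by
  unfold coinMeasure
  have := Measure.infinitePi_map_piCongrLeft (fun _ : ℤ ⊕ ℤ => fairCoin) σ.symm
  convert this using 2
  ext e i
  conv_rhs => rw [← σ.symm_apply_apply i]
  rw [MeasurableEquiv.piCongrLeft_apply_apply]

lemma measurable_xor_comp (c : ℤ ⊕ ℤ → Bool) (σ : Equiv.Perm (ℤ ⊕ ℤ)) :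
    Measurable (fun (e : CoinSpace) i => xor (c i) (e (σ i))) :=
  measurable_pi_lambda _ fun i => (measurable_of_finite (xor (c i))).comp (measurable_pi_apply _)

lemma coinMeasure_map (c : ℤ ⊕ ℤ → Bool) (σ : Equiv.Perm (ℤ ⊕ ℤ)) :
    coinMeasure.map (fun e i => xor (c i) (e (σ i))) = coinMeasure := by
  have := Measure.map_map (μ := coinMeasure) (f := fun e i => e (σ i))
    (g := fun e i => xor (c i) (e i)) (measurable_xor_comp c (Equiv.refl _)) (by fun_prop)
  rw [coinMeasure_map_comp, coinMeasure_map_xor] at this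
  exact this.symm

/-- One inequality is enough for upper bounds, and it needs no measurability of `A`. -/
lemma coinMeasure_preimage_le (c : ℤ ⊕ ℤ → Bool) (σ : Equiv.Perm (ℤ ⊕ ℤ)) (A : Set CoinSpace) :
    coinMeasure ((fun e i => xor (c i) (e (σ i))) ⁻¹' A) ≤ coinMeasure A := by
  conv_rhs => rw [← coinMeasure_map c σ]
  exact Measure.le_map_apply (measurable_xor_comp c σ).aemeasurable A

lemma coinMeasure_cylinder (s : Finset (ℤ ⊕ ℤ)) (b : ℤ ⊕ ℤ → Bool) :
    coinMeasure {e | ∀ i ∈ s, e i = b i} = 2⁻¹ ^ s.card := by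
  have := Measure.infinitePi_pi (fun _ : ℤ ⊕ ℤ => fairCoin) (s := s) (t := fun i => {b i})
    (fun i _ => measurableSet_singleton _)
  simp only [fairCoin_singleton, Finset.prod_const] at this
  rw [← this]
  rfl

/-- The environment in which the orientation of the vertical line at `k` is reversed. -/
def CoinSpace.flip (k : ℤ) (e : CoinSpace) : CoinSpace :=
  fun i => xor (decide (i = Sum.inr k)) (e i)

lemma CoinSpace.measurable_flip (k : ℤ) : Measurable (CoinSpace.flip k) := by
  unfold CoinSpace.flip
  exact measurable_xor_comp _ (Equiv.refl _)

lemma coinMeasure_map_flip (k : ℤ) : coinMeasure.map (CoinSpace.flip k) = coinMeasure :=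
  coinMeasure_map_xor _

lemma CoinSpace.horiz_flip (k : ℤ) (e : CoinSpace) : (e.flip k).horiz = e.horiz := by
  ext y; simp [CoinSpace.flip, CoinSpace.horiz]

lemma CoinSpace.vert_flip_self (k : ℤ) (e : CoinSpace) : (e.flip k).vert k = -e.vert k := by
  simp [CoinSpace.flip, CoinSpace.vert, boolSign_not]

lemma CoinSpace.vert_flip_of_ne {k x : ℤ} (h : x ≠ k) (e : CoinSpace) :
    (e.flip k).vert x = e.vert x := by
  simp [CoinSpace.flip, CoinSpace.vert, h]

/-- Averaging over the two orientations of column `k` replaces conditioning on the other columns. In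
this direction superadditivity of the lower integral suffices, so `f` need not be measurable. -/
lemma two_mul_lintegral_le_flip (k : ℤ) (f : CoinSpace → ℝ≥0∞) :
    2 * ∫⁻ e, f e ∂coinMeasure ≤ ∫⁻ e, (f e + f (e.flip k)) ∂coinMeasure := by
  calc 2 * ∫⁻ e, f e ∂coinMeasure
      = ∫⁻ e, f e ∂coinMeasure + ∫⁻ e, f e ∂(coinMeasure.map (CoinSpace.flip k)) := by
        rw [coinMeasure_map_flip, two_mul]
    _ ≤ ∫⁻ e, f e ∂coinMeasure + ∫⁻ e, f (e.flip k) ∂coinMeasure := by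
        exact add_le_add le_rfl (lintegral_map_le f (CoinSpace.flip k))
    _ ≤ _ := le_lintegral_add _ _

lemma two_mul_lintegral_eq_flip (k : ℤ) {f : CoinSpace → ℝ≥0∞} (hf : Measurable f) :
    2 * ∫⁻ e, f e ∂coinMeasure = ∫⁻ e, (f e + f (e.flip k)) ∂coinMeasure := by
  rw [lintegral_add_left hf, ← lintegral_map hf (CoinSpace.measurable_flip k),
    coinMeasure_map_flip, two_mul]

/-- The environment seen from the vertex `o`. -/
def CoinSpace.shift (o : ℤ × ℤ) (e : CoinSpace) : CoinSpace :=
  fun i => e (Equiv.sumCongr (Equiv.addRight o.2) (Equiv.addRight o.1) i)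

lemma coinMeasure_map_shift (o : ℤ × ℤ) :
    coinMeasure.map (CoinSpace.shift o) = coinMeasure :=
  coinMeasure_map_comp _

lemma CoinSpace.measurable_shift (o : ℤ × ℤ) : Measurable (CoinSpace.shift o) := by
  unfold CoinSpace.shift; fun_prop

/-- The environment in which the coordinates are exchanged. -/
def CoinSpace.swap (e : CoinSpace) : CoinSpace := fun i => e (Equiv.sumComm ℤ ℤ i)

/-- The environment reflected in the vertical axis. -/
def CoinSpace.reflect (e : CoinSpace) : CoinSpace :=
  fun i => xor (i.isLeft) (e (Equiv.sumCongr (Equiv.refl ℤ) (Equiv.neg ℤ) i))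

lemma CoinSpace.horiz_reflect (e : CoinSpace) (y : ℤ) : e.reflect.horiz y = -e.horiz y := by
  simp [CoinSpace.reflect, CoinSpace.horiz, boolSign_not]

lemma CoinSpace.vert_reflect (e : CoinSpace) (x : ℤ) : e.reflect.vert x = e.vert (-x) := by
  simp [CoinSpace.reflect, CoinSpace.vert]

lemma coinMeasure_swap_le (A : Set CoinSpace) :
    coinMeasure (CoinSpace.swap ⁻¹' A) ≤ coinMeasure A := by
  have := coinMeasure_preimage_le (fun _ => false) (Equiv.sumComm ℤ ℤ) A
  simp only [Bool.false_xor] at this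
  exact this

lemma coinMeasure_reflect_le (A : Set CoinSpace) :
    coinMeasure (CoinSpace.reflect ⁻¹' A) ≤ coinMeasure A :=
  coinMeasure_preimage_le (fun i => i.isLeft) _ A

lemma coinMeasure_shift_le (o : ℤ × ℤ) (A : Set CoinSpace) :
    coinMeasure (CoinSpace.shift o ⁻¹' A) ≤ coinMeasure A := by
  conv_rhs => rw [← coinMeasure_map_shift o]
  exact Measure.le_map_apply (CoinSpace.measurable_shift o).aemeasurable A

/-! ### The walk and its first hits of columns -/

/-- The position after `t` steps of the walk started at `o`. -/
def manhattanWalk (U V : ℤ → ℤ) (o : ℤ × ℤ) (t : ℕ) : ℤ × ℤ := (manhattanStep U V)^[t] o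

lemma manhattanWalk_zero (U V : ℤ → ℤ) (o : ℤ × ℤ) : manhattanWalk U V o 0 = o := rfl

lemma manhattanWalk_succ (U V : ℤ → ℤ) (o : ℤ × ℤ) (t : ℕ) :
    manhattanWalk U V o (t + 1) = manhattanStep U V (manhattanWalk U V o t) :=
  Function.iterate_succ_apply' _ _ _

lemma manhattanWalk_add (U V : ℤ → ℤ) (o : ℤ × ℤ) (s t : ℕ) :
    manhattanWalk U V o (s + t) = manhattanWalk U V (manhattanWalk U V o t) s :=
  Function.iterate_add_apply _ _ _ _

/-- The walk from the origin hits the column `k` for the first time at time `t`, its height being at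
most `n` in absolute value until then. -/
def FirstHit (U V : ℤ → ℤ) (n k : ℤ) (t : ℕ) : Prop :=
  (manhattanWalk U V 0 t).1 = k ∧ (∀ s < t, (manhattanWalk U V 0 s).1 < k) ∧
    ∀ s ≤ t, |(manhattanWalk U V 0 s).2| ≤ n

section

variable {U V V' : ℤ → ℤ} {n k : ℤ} {t t' : ℕ}

/-- A step reads only the column it leaves, so the orientation of column `k` plays no role up to the
first visit there. -/
lemma manhattanWalk_congr (hV : ∀ x < k, V x = V' x)
    (ht : ∀ s < t, (manhattanWalk U V 0 s).1 < k) :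
    ∀ s ≤ t, manhattanWalk U V' 0 s = manhattanWalk U V 0 s := by
  intro s
  induction s with
  | zero => intro _; rfl
  | succ s ih =>
    intro hs
    rw [manhattanWalk_succ, manhattanWalk_succ, ih (by omega), manhattanStep, manhattanStep,
      hV _ (ht s hs)]

lemma FirstHit.congr (hV : ∀ x < k, V x = V' x) (h : FirstHit U V n k t) :
    FirstHit U V' n k t := by
  have := manhattanWalk_congr hV h.2.1
  refine ⟨by rw [this t le_rfl, h.1], fun s hs => ?_, fun s hs => ?_⟩
  · rw [this s hs.le]; exact h.2.1 s hs
  · rw [this s hs]; exact h.2.2 s hs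

/-- Horizontal steps have length one, so no column between the start and `k'` can be jumped over. -/
lemma FirstHit.exists_le (hU : ∀ y, U y = 1 ∨ U y = -1) (hk : 0 ≤ k) {k' : ℤ} (hkk : k ≤ k')
    (h : (manhattanWalk U V 0 t).1 = k')
    (hn : ∀ s ≤ t, |(manhattanWalk U V 0 s).2| ≤ n) : ∃ s, FirstHit U V n k s := by
  have hex : ∃ s, k ≤ (manhattanWalk U V 0 s).1 := ⟨t, by omega⟩
  classical
  have hle : Nat.find hex ≤ t := Nat.find_min' hex (by omega)
  have hlt : ∀ s < Nat.find hex, (manhattanWalk U V 0 s).1 < k := fun s hs =>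
    not_le.1 (Nat.find_min hex hs)
  refine ⟨Nat.find hex, le_antisymm ?_ (Nat.find_spec hex), hlt, fun s hs => hn s (hs.trans hle)⟩
  rcases hc : Nat.find hex with _ | s
  · simpa [manhattanWalk_zero] using hk
  · have h1 := hlt s (by omega)
    rw [manhattanWalk_succ, manhattanStep]
    rcases hU (manhattanWalk U V 0 s).2 with h2 | h2 <;> simp only [h2] <;> omega

lemma FirstHit.exists_prev (hU : ∀ y, U y = 1 ∨ U y = -1) (hk : 0 ≤ k)
    (h : FirstHit U V n (k + 1) t) : ∃ s, FirstHit U V n k s :=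
  FirstHit.exists_le hU hk (by omega) h.1 h.2.2

lemma FirstHit.next (h : FirstHit U V n k t) (hU : U (manhattanWalk U V 0 t).2 = 1)
    (h' : FirstHit U V n (k + 1) t') :
    (manhattanWalk U V 0 t').2 = (manhattanWalk U V 0 t).2 + V k := by
  have hstep : manhattanWalk U V 0 (t + 1) = (k + 1, (manhattanWalk U V 0 t).2 + V k) := by
    rw [manhattanWalk_succ, manhattanStep, hU, h.1]
  have : t' = t + 1 := by
    rcases lt_trichotomy t' (t + 1) with hlt | rfl | hlt
    · rcases Nat.lt_succ_iff_lt_or_eq.1 hlt with h1 | rfl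
      · have := h.2.1 t' h1
        rw [h'.1] at this; omega
      · have := h.1
        rw [h'.1] at this; omega
    · rfl
    · have := h'.2.1 (t + 1) hlt
      rw [hstep] at this
      simp at this
  rw [this, hstep]

/-- The walk came from column `k - 1` with vertical step `V (k - 1)`; it goes back there with
vertical step `V k = -V (k - 1)`, that is, to the vertex it came from. From then on it has period
two. The bound `1 ≤ k` guarantees that there was a previous step. -/
lemma FirstHit.trapped (hU : ∀ y, U y = 1 ∨ U y = -1) (hk : 1 ≤ k) (h : FirstHit U V n k t)
    (hy : U (manhattanWalk U V 0 t).2 = -1) (hV : V k = -V (k - 1)) :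
    ¬ FirstHit U V n (k + 1) t' := by
  intro h'
  obtain _ | t := t
  · have := h.1
    simp [manhattanWalk_zero] at this
    omega
  set p := manhattanWalk U V 0 t with hp
  have hlt : p.1 < k := h.2.1 t (by omega)
  have h1 := h.1
  have e1 : manhattanWalk U V 0 (t + 1) = (p.1 + U p.2, p.2 + V p.1) := by
    rw [manhattanWalk_succ, manhattanStep]
  rw [e1] at h1 hy
  simp only at h1 hy
  have hpk : p.1 = k - 1 ∧ U p.2 = 1 := by
    rcases hU p.2 with h2 | h2 <;> rw [h2] at h1
    · exact ⟨by omega, h2⟩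
    · omega
  have e2 : manhattanWalk U V 0 (t + 1 + 1) = p := by
    rw [manhattanWalk_succ, e1, manhattanStep, h1]
    simp only [hy, hV]
    ext
    · simp only; omega
    · simp only [hpk.1]; ring
  have key : ∀ s, (manhattanWalk U V 0 (t + 2 * s)) = p := by
    intro s
    induction s with
    | zero => rfl
    | succ s ih =>
      have : t + 2 * (s + 1) = 2 + (t + 2 * s) := by ring
      rw [this, manhattanWalk_add, ih, hp, ← manhattanWalk_add, add_comm, ← hp]
      exact e2
  have key' : ∀ s, (manhattanWalk U V 0 s).1 ≤ k := by
    intro s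
    rcases lt_or_ge s t with hs | hs
    · exact (h.2.1 s (by omega)).le
    · rcases Nat.even_or_odd' (s - t) with ⟨c, hc | hc⟩
      · have : s = t + 2 * c := by omega
        rw [this, key, hpk.1]; omega
      · have : s = t + 2 * c + 1 := by omega
        rw [this, manhattanWalk_succ, key, ← manhattanWalk_succ, h.1]
  have := key' t'
  rw [h'.1] at this
  omega

end

/-! ### A superharmonic weight on the gaps -/

/-- The distance from `y` to the nearest point at or below it where `U` is `-1`. -/
noncomputable def gapBelow (U : ℤ → ℤ) (y : ℤ) : ℕ := sInf {j : ℕ | U (y - j) = -1}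

lemma gapBelow_eq_zero {U : ℤ → ℤ} {y : ℤ} (h : U y = -1) : gapBelow U y = 0 :=
  Nat.sInf_eq_zero.2 (Or.inl (by simpa using h))

lemma gapBelow_le {U : ℤ → ℤ} {y : ℤ} {j : ℕ} (h : U (y - j) = -1) : gapBelow U y ≤ j :=
  Nat.sInf_le h

lemma gapBelow_eq_succ {U : ℤ → ℤ} {y : ℤ} (hy : U y = 1) (h : ∃ j : ℕ, U (y - j) = -1) :
    gapBelow U y = gapBelow U (y - 1) + 1 := by
  obtain ⟨j, hj⟩ := h
  apply le_antisymm
  · apply gapBelow_le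
    have hne : {i : ℕ | U (y - 1 - i) = -1}.Nonempty := by
      obtain _ | j := j
      · simp [hy] at hj
      · exact ⟨j, by simpa [sub_sub, add_comm] using hj⟩
    have := Nat.sInf_mem hne
    simp only [Set.mem_ofPred_eq] at this
    rw [← this, gapBelow]
    congr 1
    push_cast
    ring
  · have hne : {i : ℕ | U (y - i) = -1}.Nonempty := ⟨j, hj⟩
    have hm := Nat.sInf_mem hne
    change U (y - (gapBelow U y : ℕ)) = -1 at hm
    rcases hi : gapBelow U y with _ | i
    · simp [hi, hy] at hm
    · rw [hi] at hm
      exact Nat.succ_le_succ (gapBelow_le (by rw [← hm]; congr 1; push_cast; ring))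

/-- A function which vanishes where `U` is `-1`, and is quadratic on the intervals where `U` is `1`. -/
noncomputable def gapProduct (U : ℤ → ℤ) (y : ℤ) : ℕ :=
  gapBelow U y * gapBelow (fun z => U (-z)) (-y)

lemma gapProduct_reflect (U : ℤ → ℤ) (y : ℤ) :
    gapProduct (fun z => U (-z)) (-y) = gapProduct U y := by
  simp [gapProduct, mul_comm]

/-- Moving up lengthens the lower gap by one and shortens the upper gap by one. The formula survives
at the end of the interval: if `U (y + 1) = -1`, the upper gap at `y` is 1 and both sides vanish. -/
lemma gapProduct_succ {U : ℤ → ℤ} (hU : ∀ y, U y = 1 ∨ U y = -1) {y : ℤ} (hy : U y = 1)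
    (h1 : ∃ j : ℕ, U (y - j) = -1) (h2 : ∃ j : ℕ, U (y + j) = -1) :
    (gapProduct U (y + 1) : ℝ) = ((gapBelow U y : ℝ) + 1) *
      ((gapBelow (fun z => U (-z)) (-y) : ℝ) - 1) := by
  have e1 : gapBelow (fun z => U (-z)) (-y) = gapBelow (fun z => U (-z)) (-(y + 1)) + 1 := by
    rw [gapBelow_eq_succ (U := fun z => U (-z)) (y := -y) (by simpa using hy), neg_add,
      sub_eq_add_neg]
    obtain ⟨j, hj⟩ := h2
    exact ⟨j, by simpa [add_comm] using hj⟩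
  rw [e1, gapProduct]
  rcases hU (y + 1) with h | h
  · obtain ⟨j, hj⟩ := h1
    rw [gapBelow_eq_succ h ⟨j + 1, by simpa using hj⟩]
    push_cast
    simp
  · have e2 : gapBelow (fun z => U (-z)) (-(y + 1)) = 0 := gapBelow_eq_zero (by simpa using h)
    rw [e2]
    simp

lemma gapProduct_pred {U : ℤ → ℤ} (hU : ∀ y, U y = 1 ∨ U y = -1) {y : ℤ} (hy : U y = 1)
    (h1 : ∃ j : ℕ, U (y - j) = -1) (h2 : ∃ j : ℕ, U (y + j) = -1) :
    (gapProduct U (y - 1) : ℝ) = ((gapBelow U y : ℝ) - 1) *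
      ((gapBelow (fun z => U (-z)) (-y) : ℝ) + 1) := by
  have := gapProduct_succ (U := fun z => U (-z)) (y := -y) (fun z => hU _) (by simpa using hy)
    (by simpa [add_comm] using h2) (by simpa [sub_eq_add_neg, add_comm] using h1)
  have e : -y + 1 = -(y - 1) := by ring
  rw [e, gapProduct_reflect] at this
  rw [this]
  simp [mul_comm]

/-- Every height between `-n` and `n` is within distance `W`, in both directions, of a height where
`U` is `-1`. -/
def HasShortGaps (U : ℤ → ℤ) (n : ℤ) (W : ℕ) : Prop :=
  ∀ y, |y| ≤ n → (∃ j : ℕ, j ≤ W ∧ U (y - j) = -1) ∧ ∃ j : ℕ, j ≤ W ∧ U (y + j) = -1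

/-- A strictly superharmonic weight for the simple random walk on the intervals where `U` is `1`. -/
noncomputable def gapWeight (U : ℤ → ℤ) (W : ℕ) (y : ℤ) : ℝ := 1 + gapProduct U y / (4 * W ^ 2)

lemma one_le_gapWeight (U : ℤ → ℤ) (W : ℕ) (y : ℤ) : 1 ≤ gapWeight U W y := by
  unfold gapWeight
  have : (0 : ℝ) ≤ gapProduct U y / (4 * W ^ 2) := by positivity
  linarith

lemma gapWeight_le {U : ℤ → ℤ} {n : ℤ} {W : ℕ} (hW : 1 ≤ W) (h : HasShortGaps U n W) {y : ℤ}
    (hy : |y| ≤ n) : gapWeight U W y ≤ 5 / 4 := by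
  obtain ⟨⟨i, hi, h1⟩, j, hj, h2⟩ := h y hy
  have hp : gapProduct U y ≤ W * W := Nat.mul_le_mul ((gapBelow_le h1).trans hi)
    ((gapBelow_le (j := j) (by simpa [add_comm] using h2)).trans hj)
  have hp' : (gapProduct U y : ℝ) ≤ W * W := by exact_mod_cast hp
  have hW' : (1 : ℝ) ≤ W := by exact_mod_cast hW
  have : (gapProduct U y : ℝ) / (4 * W ^ 2) ≤ 1 / 4 := by
    rw [div_le_div_iff₀ (by positivity) (by norm_num)]
    nlinarith
  unfold gapWeight
  linarith

/-- With gaps `a` and `b`, `(a+1)(b-1) + (a-1)(b+1) = 2ab - 2`, so the average drops by `1/(4W²)`.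
Since the weight is at most 5/4, this is at least a fraction `1/(5W²)` of it. Only the gaps at `y`
enter, so `y ± 1` may lie outside the range of `HasShortGaps`. -/
lemma gapWeight_superharmonic {U : ℤ → ℤ} (hU : ∀ y, U y = 1 ∨ U y = -1) {n : ℤ} {W : ℕ}
    (hW : 1 ≤ W) (h : HasShortGaps U n W) {y : ℤ} (hy : |y| ≤ n) (hy1 : U y = 1) :
    gapWeight U W (y + 1) + gapWeight U W (y - 1) ≤
      2 * (1 - 1 / (5 * (W : ℝ) ^ 2)) * gapWeight U W y := by
  have hle := gapWeight_le hW h hy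
  obtain ⟨⟨i, hi, h1⟩, j, hj, h2⟩ := h y hy
  have hW' : (1 : ℝ) ≤ W := by exact_mod_cast hW
  have e : gapWeight U W (y + 1) + gapWeight U W (y - 1) =
      2 * gapWeight U W y - 2 * (1 / (4 * (W : ℝ) ^ 2)) := by
    unfold gapWeight
    rw [gapProduct_succ hU hy1 ⟨i, h1⟩ ⟨j, h2⟩, gapProduct_pred hU hy1 ⟨i, h1⟩ ⟨j, h2⟩, gapProduct]
    push_cast
    field_simp
    ring_nf
  rw [e]
  have : 1 / (5 * (W : ℝ) ^ 2) * gapWeight U W y ≤ 1 / (4 * (W : ℝ) ^ 2) := by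
    calc 1 / (5 * (W : ℝ) ^ 2) * gapWeight U W y ≤ 1 / (5 * (W : ℝ) ^ 2) * (5 / 4) := by gcongr
      _ = _ := by field_simp
  linarith

/-- The weight of the height at which the walk from the origin first hits the column `k`, and `0` if
it does not. -/
noncomputable def hitWeight (U V : ℤ → ℤ) (n : ℤ) (W : ℕ) (k : ℤ) : ℝ≥0∞ :=
  ⨆ (t : ℕ) (_ : FirstHit U V n k t), ENNReal.ofReal (gapWeight U W (manhattanWalk U V 0 t).2)

section

variable {U V V' : ℤ → ℤ} {n k : ℤ} {W : ℕ}

lemma hitWeight_le (hW : 1 ≤ W) (h : HasShortGaps U n W) :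
    hitWeight U V n W k ≤ ENNReal.ofReal (5 / 4) :=
  iSup₂_le fun t ht => ENNReal.ofReal_le_ofReal (gapWeight_le hW h (ht.2.2 t le_rfl))

lemma FirstHit.ofReal_le_hitWeight {t : ℕ} (h : FirstHit U V n k t) :
    ENNReal.ofReal (gapWeight U W (manhattanWalk U V 0 t).2) ≤ hitWeight U V n W k :=
  le_iSup₂_of_le t h le_rfl

/-- `V` and `V'` are the two equally likely continuations after the first hit of column `k`; this is
the one-step supermartingale estimate with contraction factor `1 - 1/(5W²)`. -/
lemma hitWeight_add_le (hU : ∀ y, U y = 1 ∨ U y = -1) (hV : ∀ x, V x = 1 ∨ V x = -1)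
    (hVV : ∀ x < k, V x = V' x) (hk : V' k = -V k) (h1k : 1 ≤ k) (hW : 1 ≤ W)
    (h : HasShortGaps U n W) :
    hitWeight U V n W (k + 1) + hitWeight U V' n W (k + 1) ≤
      2 * ENNReal.ofReal (1 - 1 / (5 * (W : ℝ) ^ 2)) * hitWeight U V n W k := by
  have hW' : (1 : ℝ) ≤ W := by exact_mod_cast hW
  have heps : 1 / (5 * (W : ℝ) ^ 2) ≤ 1 / 5 := by
    apply one_div_le_one_div_of_le (by norm_num)
    nlinarith
  by_cases hex : ∃ t, FirstHit U V n k t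
  swap
  · have z : ∀ V'', (∀ x < k, V x = V'' x) → hitWeight U V'' n W (k + 1) = 0 := by
      intro V'' h2
      refine le_antisymm (iSup₂_le fun t ht => ?_) zero_le
      obtain ⟨s, hs⟩ := ht.exists_prev hU (by omega)
      exact absurd ⟨s, hs.congr fun x hx => (h2 x hx).symm⟩ hex
    rw [z V fun _ _ => rfl, z V' hVV]
    simp
  obtain ⟨t, ht⟩ := hex
  have ht' := ht.congr hVV
  have hw := manhattanWalk_congr hVV ht.2.1 t le_rfl
  set y := (manhattanWalk U V 0 t).2 with hy
  have hyn : |y| ≤ n := ht.2.2 t le_rfl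
  have hmain : 2 * ENNReal.ofReal (1 - 1 / (5 * (W : ℝ) ^ 2)) *
      ENNReal.ofReal (gapWeight U W y) ≤
      2 * ENNReal.ofReal (1 - 1 / (5 * (W : ℝ) ^ 2)) * hitWeight U V n W k := by
    gcongr
    exact ht.ofReal_le_hitWeight
  refine le_trans ?_ hmain
  have e2 : (2 : ℝ≥0∞) = ENNReal.ofReal 2 := by simp
  rw [e2, ← ENNReal.ofReal_mul (by norm_num), ← ENNReal.ofReal_mul (by linarith)]
  rcases hU y with hy1 | hy1
  · have b1 : hitWeight U V n W (k + 1) ≤ ENNReal.ofReal (gapWeight U W (y + V k)) :=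
      iSup₂_le fun s hs => by rw [ht.next hy1 hs]
    have b2 : hitWeight U V' n W (k + 1) ≤ ENNReal.ofReal (gapWeight U W (y - V k)) := by
      refine iSup₂_le fun s hs => ?_
      rw [ht'.next (by rw [hw]; exact hy1) hs, hw, hk, sub_eq_add_neg]
    refine (add_le_add b1 b2).trans ?_
    rw [← ENNReal.ofReal_add (by linarith [one_le_gapWeight U W (y + V k)])
      (by linarith [one_le_gapWeight U W (y - V k)])]
    apply ENNReal.ofReal_le_ofReal
    have := gapWeight_superharmonic hU hW h hyn hy1
    rcases hV k with h3 | h3 <;> rw [h3]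
    · exact this
    · rw [add_comm, sub_neg_eq_add]; exact this
  -- At a height with `U = -1` one of the two continuations is trapped. The other contributes at
  -- most 5/4, while the right side is at least `2 * (4/5) * 1`.
  · have hb : ENNReal.ofReal (5 / 4) ≤
        ENNReal.ofReal (2 * (1 - 1 / (5 * (W : ℝ) ^ 2)) * gapWeight U W y) := by
      apply ENNReal.ofReal_le_ofReal
      nlinarith [one_le_gapWeight U W y]
    by_cases hc : V k = -V (k - 1)
    · have z : hitWeight U V n W (k + 1) = 0 :=
        le_antisymm (iSup₂_le fun s hs => absurd hs (ht.trapped hU h1k hy1 hc)) zero_le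
      rw [z, zero_add]
      exact (hitWeight_le hW h).trans hb
    · have hc' : V' k = -V' (k - 1) := by
        rw [hk, ← hVV (k - 1) (by omega)]
        rcases hV k with h3 | h3 <;> rcases hV (k - 1) with h4 | h4 <;> omega
      have z : hitWeight U V' n W (k + 1) = 0 :=
        le_antisymm (iSup₂_le fun s hs => absurd hs
          (ht'.trapped hU h1k (by rw [hw]; exact hy1) hc')) zero_le
      rw [z, add_zero]
      exact (hitWeight_le hW h).trans hb

end

/-! ### Probability of crossing many columns -/

lemma CoinSpace.measurable_horiz (y : ℤ) : Measurable fun e : CoinSpace => e.horiz y :=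
  (measurable_of_finite boolSign).comp (measurable_pi_apply _)

lemma CoinSpace.measurable_vert (x : ℤ) : Measurable fun e : CoinSpace => e.vert x :=
  (measurable_of_finite boolSign).comp (measurable_pi_apply _)

lemma measurable_coinWalk (o : ℤ × ℤ) (t : ℕ) :
    Measurable fun e : CoinSpace => manhattanWalk e.horiz e.vert o t := by
  induction t with
  | zero => simp only [manhattanWalk_zero]; exact measurable_const
  | succ t ih =>
    have h : Measurable fun q : CoinSpace × (ℤ × ℤ) => manhattanStep q.1.horiz q.1.vert q.2 := by
      refine measurable_from_prod_countable_left fun v => ?_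
      exact (Measurable.const_add (CoinSpace.measurable_horiz v.2) v.1).prodMk
        (Measurable.const_add (CoinSpace.measurable_vert v.1) v.2)
    simp only [manhattanWalk_succ]
    exact h.comp (measurable_id.prodMk ih)

lemma measurableSet_firstHit (n k : ℤ) (t : ℕ) :
    MeasurableSet {e : CoinSpace | FirstHit e.horiz e.vert n k t} := by
  have h : ∀ s, ∀ A : Set (ℤ × ℤ),
      MeasurableSet {e : CoinSpace | manhattanWalk e.horiz e.vert 0 s ∈ A} := fun s A =>
    measurable_coinWalk 0 s A.to_countable.measurableSet
  have := (h t {v | v.1 = k}).inter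
    ((MeasurableSet.iInter fun s => MeasurableSet.iInter fun _ : s < t => h s {v | v.1 < k}).inter
    (MeasurableSet.iInter fun s => MeasurableSet.iInter fun _ : s ≤ t => h s {v | |v.2| ≤ n}))
  convert this using 1
  ext e
  simp [FirstHit]

lemma measurableSet_hasShortGaps (n : ℤ) (W : ℕ) :
    MeasurableSet {e : CoinSpace | HasShortGaps e.horiz n W} := by
  have h : ∀ z, MeasurableSet {e : CoinSpace | e.horiz z = -1} := fun z =>
    CoinSpace.measurable_horiz z (measurableSet_singleton _)
  have := MeasurableSet.iInter fun y : ℤ => MeasurableSet.iInter fun _ : |y| ≤ n =>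
    (MeasurableSet.iUnion fun j : ℕ => MeasurableSet.iUnion fun _ : j ≤ W => h (y - j)).inter
    (MeasurableSet.iUnion fun j : ℕ => MeasurableSet.iUnion fun _ : j ≤ W => h (y + j))
  convert this using 1
  ext e
  simp [HasShortGaps]

lemma coinMeasure_long_interval_le {f : ℕ → ℤ} (hf : Function.Injective f) (W : ℕ) :
    coinMeasure {e | ∀ j ≤ W, e.horiz (f j) ≠ -1} ≤ 2⁻¹ ^ (W + 1) := by
  have hinj : Function.Injective fun j => (Sum.inl (f j) : ℤ ⊕ ℤ) := Sum.inl_injective.comp hf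
  have h := coinMeasure_cylinder ((Finset.range (W + 1)).image fun j => Sum.inl (f j))
    fun _ => true
  rw [Finset.card_image_of_injective _ hinj, Finset.card_range] at h
  rw [← h]
  refine measure_mono fun e he => ?_
  simp only [Set.mem_ofPred_eq, Finset.mem_image, Finset.mem_range] at he ⊢
  rintro _ ⟨j, hj, rfl⟩
  have := he j (by omega)
  by_contra hc
  simp [CoinSpace.horiz, boolSign, hc] at this

/-- Union bound over `2n + 1` heights and two directions, each failing with probability at most
`2^(-(W+1))`. -/
lemma coinMeasure_not_hasShortGaps_le (n W : ℕ) :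
    coinMeasure {e | ¬ HasShortGaps e.horiz n W} ≤ (2 * n + 1 : ℕ) * 2⁻¹ ^ W := by
  have hsub : {e : CoinSpace | ¬ HasShortGaps e.horiz n W} ⊆
      ⋃ y ∈ Finset.Icc (-n : ℤ) n, ({e | ∀ j ≤ W, e.horiz (y - (j : ℕ)) ≠ -1} ∪
        {e | ∀ j ≤ W, e.horiz (y + (j : ℕ)) ≠ -1}) := by
    intro e he
    simp only [Set.mem_ofPred_eq, HasShortGaps, not_forall, not_and_or, not_exists] at he
    obtain ⟨y, hy, h⟩ := he
    simp only [Set.mem_iUnion]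
    refine ⟨y, Finset.mem_Icc.2 (abs_le.1 hy), ?_⟩
    rcases h with h | h
    · exact Or.inl fun j hj hc => (h j).elim (fun h => h hj) fun h => h hc
    · exact Or.inr fun j hj hc => (h j).elim (fun h => h hj) fun h => h hc
  calc coinMeasure {e | ¬ HasShortGaps e.horiz n W}
      ≤ ∑ y ∈ Finset.Icc (-n : ℤ) n, ((2⁻¹ : ℝ≥0∞) ^ (W + 1) + 2⁻¹ ^ (W + 1)) := by
        refine (measure_mono hsub).trans ((measure_biUnion_finset_le _ _).trans ?_)
        refine Finset.sum_le_sum fun y _ => (measure_union_le _ _).trans (add_le_add ?_ ?_)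
        · exact coinMeasure_long_interval_le (f := fun j => y - j) (fun a b h => by
            simpa using h) W
        · exact coinMeasure_long_interval_le (f := fun j => y + j) (fun a b h => by
            simpa using h) W
    _ = (2 * n + 1 : ℕ) * 2⁻¹ ^ W := by
        rw [Finset.sum_const, Int.card_Icc, nsmul_eq_mul, ← mul_two, pow_succ, mul_assoc,
          ENNReal.inv_mul_cancel (by norm_num) (by norm_num), mul_one]
        congr 2
        omega

/-- The environments in which the walk from the origin reaches the column `n` before its height
exceeds `n` in absolute value. -/
def crossingSet (n : ℕ) : Set CoinSpace := {e | ∃ t, FirstHit e.horiz e.vert n n t}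

lemma measurableSet_crossingSet (n : ℕ) : MeasurableSet (crossingSet n) := by
  have := MeasurableSet.iUnion fun t => measurableSet_firstHit n n t
  convert this using 1
  ext e
  simp [crossingSet]

/-- The induction starts at column 1 because a trap at column `k` involves column `k - 1`. The event
of short gaps depends on `U` only, hence is unaffected by flipping a column. -/
lemma lintegral_hitWeight_le (n W : ℕ) (hW : 1 ≤ W) (k : ℕ) :
    ∫⁻ e : CoinSpace, {e | HasShortGaps e.horiz n W}.indicator
      (fun e => hitWeight e.horiz e.vert n W (k + 1)) e ∂coinMeasure ≤
      ENNReal.ofReal (5 / 4) * ENNReal.ofReal (1 - 1 / (5 * (W : ℝ) ^ 2)) ^ k := by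
  induction k with
  | zero =>
    calc _ ≤ ∫⁻ e : CoinSpace, ENNReal.ofReal (5 / 4) ∂coinMeasure := by
          refine lintegral_mono fun e => ?_
          exact Set.indicator_apply_le' (fun he => hitWeight_le hW he) fun _ => zero_le
      _ = _ := by simp
  | succ k ih =>
    set f : ℕ → CoinSpace → ℝ≥0∞ := fun k => {e | HasShortGaps e.horiz n W}.indicator
      (fun e => hitWeight e.horiz e.vert n W (k + 1)) with hf
    set ρ := ENNReal.ofReal (1 - 1 / (5 * (W : ℝ) ^ 2)) with hρ
    change ∫⁻ e, f k e ∂coinMeasure ≤ _ at ih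
    change ∫⁻ e, f (k + 1) e ∂coinMeasure ≤ _
    have h1 : 2 * ∫⁻ e, f (k + 1) e ∂coinMeasure ≤ 2 * (ρ * ∫⁻ e, f k e ∂coinMeasure) := by
      calc 2 * ∫⁻ e, f (k + 1) e ∂coinMeasure
          ≤ ∫⁻ e, (f (k + 1) e + f (k + 1) (e.flip (k + 1))) ∂coinMeasure :=
            two_mul_lintegral_le_flip _ _
        _ ≤ ∫⁻ e, 2 * ρ * f k e ∂coinMeasure := by
            refine lintegral_mono fun e => ?_
            by_cases he : HasShortGaps e.horiz n W
            · have he' : HasShortGaps (e.flip (k + 1)).horiz n W := by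
                rwa [CoinSpace.horiz_flip]
              simp only [hf]
              rw [Set.indicator_of_mem (show e ∈ {e : CoinSpace | HasShortGaps e.horiz n W} from he),
                Set.indicator_of_mem
                  (show e.flip (k + 1) ∈ {e : CoinSpace | HasShortGaps e.horiz n W} from he'),
                Set.indicator_of_mem (show e ∈ {e : CoinSpace | HasShortGaps e.horiz n W} from he),
                CoinSpace.horiz_flip]
              push_cast
              exact hitWeight_add_le e.horiz_values e.vert_values
                (fun x hx => (CoinSpace.vert_flip_of_ne hx.ne e).symm)
                (CoinSpace.vert_flip_self _ e) (by omega) hW he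
            · have he' : ¬ HasShortGaps (e.flip (k + 1)).horiz n W := by
                rwa [CoinSpace.horiz_flip]
              simp only [hf]
              rw [Set.indicator_of_notMem
                  (show e ∉ {e : CoinSpace | HasShortGaps e.horiz n W} from he),
                Set.indicator_of_notMem
                  (show e.flip (k + 1) ∉ {e : CoinSpace | HasShortGaps e.horiz n W} from he')]
              simp
        _ = 2 * (ρ * ∫⁻ e, f k e ∂coinMeasure) := by
            rw [lintegral_const_mul' _ _ (ENNReal.mul_ne_top (by norm_num) ENNReal.ofReal_ne_top),
              mul_assoc]
    have h2 := (ENNReal.mul_le_mul_iff_right (by norm_num) (by norm_num)).1 h1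
    calc ∫⁻ e, f (k + 1) e ∂coinMeasure ≤ ρ * ∫⁻ e, f k e ∂coinMeasure := h2
      _ ≤ ρ * (ENNReal.ofReal (5 / 4) * ρ ^ k) := by gcongr
      _ = _ := by ring

/-- The weight is at least 1 at every hit, so its integral dominates the probability of crossing
with short gaps. -/
lemma coinMeasure_crossingSet_le (n W : ℕ) (hn : 1 ≤ n) (hW : 1 ≤ W) :
    coinMeasure (crossingSet n) ≤ (2 * n + 1 : ℕ) * 2⁻¹ ^ W +
      ENNReal.ofReal (5 / 4) * ENNReal.ofReal (1 - 1 / (5 * (W : ℝ) ^ 2)) ^ (n - 1) := by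
  have hG := measurableSet_hasShortGaps n W
  set G := {e : CoinSpace | HasShortGaps e.horiz n W} with hGdef
  calc coinMeasure (crossingSet n)
      ≤ coinMeasure ({e | ¬ HasShortGaps e.horiz n W} ∪ (G ∩ crossingSet n)) := by
        refine measure_mono fun e he => ?_
        by_cases h : HasShortGaps e.horiz n W
        · exact Or.inr ⟨h, he⟩
        · exact Or.inl h
    _ ≤ coinMeasure {e | ¬ HasShortGaps e.horiz n W} + coinMeasure (G ∩ crossingSet n) :=
        measure_union_le _ _
    _ ≤ _ := by
        refine add_le_add (coinMeasure_not_hasShortGaps_le n W) ?_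
        refine le_trans ?_ (lintegral_hitWeight_le n W hW (n - 1))
        rw [← lintegral_indicator_one (hG.inter (measurableSet_crossingSet n))]
        refine lintegral_mono fun e => Set.indicator_apply_le fun he => ?_
        rw [Set.indicator_of_mem he.1]
        obtain ⟨t, ht⟩ := he.2
        have e1 : ((n - 1 : ℕ) : ℤ) + 1 = n := by omega
        rw [e1]
        refine le_trans ?_ (ht.ofReal_le_hitWeight (W := W))
        simpa using one_le_gapWeight e.horiz W _

/-! ### From crossings to exits in any direction -/

/-- The distance of two vertices in the maximum norm. -/
def supDist (u v : ℤ × ℤ) : ℕ := max (u.1 - v.1).natAbs (u.2 - v.2).natAbs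

lemma manhattanWalk_reflect (U V : ℤ → ℤ) (t : ℕ) :
    manhattanWalk (fun y => -U y) (fun x => V (-x)) 0 t =
      (-(manhattanWalk U V 0 t).1, (manhattanWalk U V 0 t).2) := by
  induction t with
  | zero => ext <;> simp [manhattanWalk_zero]
  | succ t ih =>
    rw [manhattanWalk_succ, manhattanWalk_succ, ih, manhattanStep, manhattanStep]
    simp [add_comm]

lemma manhattanWalk_swap (U V : ℤ → ℤ) (t : ℕ) :
    manhattanWalk V U 0 t = (manhattanWalk U V 0 t).swap := by
  induction t with
  | zero => simp [manhattanWalk_zero]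
  | succ t ih =>
    rw [manhattanWalk_succ, manhattanWalk_succ, ih, manhattanStep, manhattanStep]
    simp

lemma manhattanWalk_shift (U V : ℤ → ℤ) (o : ℤ × ℤ) (t : ℕ) :
    manhattanWalk U V o t =
      o + manhattanWalk (fun y => U (y + o.2)) (fun x => V (x + o.1)) 0 t := by
  induction t with
  | zero => simp [manhattanWalk_zero]
  | succ t ih =>
    rw [manhattanWalk_succ, manhattanWalk_succ, ih, manhattanStep, manhattanStep]
    ext
    · simp [add_assoc, add_comm _ o.2]
    · simp [add_assoc, add_comm _ o.1]

lemma supDist_manhattanStep_le {U V : ℤ → ℤ} (hU : ∀ y, U y = 1 ∨ U y = -1)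
    (hV : ∀ x, V x = 1 ∨ V x = -1) (v : ℤ × ℤ) (o : ℤ × ℤ) :
    supDist (manhattanStep U V v) o ≤ supDist v o + 1 ∧
      supDist v o ≤ supDist (manhattanStep U V v) o + 1 := by
  simp only [supDist, manhattanStep]
  rcases hU v.2 with h | h <;> rcases hV v.1 with h' | h' <;> rw [h, h'] <;> omega

/-- The environments in which the walk started at `o` travels to distance `n`. -/
def exitSet (o : ℤ × ℤ) (n : ℕ) : Set CoinSpace :=
  {e | ∃ t, n ≤ supDist (manhattanWalk e.horiz e.vert o t) o}

/-- At the first time the maximum norm reaches `n`, it equals `n`: one coordinate is `±n`, and the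
other has stayed within `[-n, n]`. Reflection and exchange of coordinates turn each of the four
cases into a crossing to the right. -/
lemma exitSet_zero_subset (n : ℕ) : exitSet 0 n ⊆
    (crossingSet n ∪ CoinSpace.reflect ⁻¹' crossingSet n) ∪
      CoinSpace.swap ⁻¹' (crossingSet n ∪ CoinSpace.reflect ⁻¹' crossingSet n) := by
  intro e he
  classical
  have hex : ∃ t, n ≤ supDist (manhattanWalk e.horiz e.vert 0 t) 0 := he
  set T := Nat.find hex with hT
  have h1 : n ≤ supDist (manhattanWalk e.horiz e.vert 0 T) 0 := Nat.find_spec hex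
  have h2 : ∀ s < T, supDist (manhattanWalk e.horiz e.vert 0 s) 0 < n := fun s hs =>
    not_le.1 (Nat.find_min hex hs)
  have h3 : supDist (manhattanWalk e.horiz e.vert 0 T) 0 ≤ n := by
    rcases hc : T with _ | s
    · simp [manhattanWalk_zero, supDist]
    · rw [manhattanWalk_succ]
      have := h2 s (by omega)
      have := (supDist_manhattanStep_le e.horiz_values e.vert_values
        (manhattanWalk e.horiz e.vert 0 s) 0).1
      omega
  have hle : ∀ s ≤ T, |(manhattanWalk e.horiz e.vert 0 s).1| ≤ n ∧
      |(manhattanWalk e.horiz e.vert 0 s).2| ≤ n := by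
    intro s hs
    have : supDist (manhattanWalk e.horiz e.vert 0 s) 0 ≤ n := by
      rcases hs.lt_or_eq with h | h
      · exact (h2 s h).le
      · rw [h]; exact h3
    simp only [supDist, Prod.fst_zero, Prod.snd_zero, sub_zero] at this
    rw [abs_le, abs_le]
    omega
  have hcross : ∀ e' : CoinSpace, (manhattanWalk e'.horiz e'.vert 0 T).1 = n →
      (∀ s ≤ T, |(manhattanWalk e'.horiz e'.vert 0 s).2| ≤ n) → e' ∈ crossingSet n :=
    fun e' h h' => FirstHit.exists_le e'.horiz_values (by omega) le_rfl h h'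
  have hrefl : ∀ (e' : CoinSpace) s, manhattanWalk e'.reflect.horiz e'.reflect.vert 0 s =
      (-(manhattanWalk e'.horiz e'.vert 0 s).1, (manhattanWalk e'.horiz e'.vert 0 s).2) := by
    intro e' s
    rw [← manhattanWalk_reflect]
    congr 1
    · exact funext e'.horiz_reflect
    · exact funext e'.vert_reflect
  have hswap : ∀ s, manhattanWalk e.swap.horiz e.swap.vert 0 s =
      (manhattanWalk e.horiz e.vert 0 s).swap := fun s => manhattanWalk_swap _ _ s
  have h4 : (manhattanWalk e.horiz e.vert 0 T).1 = n ∨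
      (manhattanWalk e.horiz e.vert 0 T).1 = -n ∨ (manhattanWalk e.horiz e.vert 0 T).2 = n ∨
      (manhattanWalk e.horiz e.vert 0 T).2 = -n := by
    simp only [supDist, Prod.fst_zero, Prod.snd_zero, sub_zero] at h1 h3
    omega
  rcases h4 with h | h | h | h
  · exact Or.inl (Or.inl (hcross e h fun s hs => (hle s hs).2))
  · refine Or.inl (Or.inr (hcross _ ?_ fun s hs => ?_))
    · rw [hrefl, h, neg_neg]
    · rw [hrefl]; exact (hle s hs).2
  · refine Or.inr (Or.inl (hcross _ ?_ fun s hs => ?_))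
    · rw [hswap]; exact h
    · rw [hswap]; exact (hle s hs).1
  · refine Or.inr (Or.inr (hcross _ ?_ fun s hs => ?_))
    · rw [hrefl, hswap, Prod.fst_swap, h, neg_neg]
    · rw [hrefl, hswap]; exact (hle s hs).1

lemma coinMeasure_exitSet_le (o : ℤ × ℤ) (n : ℕ) :
    coinMeasure (exitSet o n) ≤ 4 * coinMeasure (crossingSet n) := by
  have h0 : exitSet o n ⊆ CoinSpace.shift o ⁻¹' exitSet 0 n := by
    rintro e ⟨t, ht⟩
    refine ⟨t, ?_⟩
    rw [manhattanWalk_shift] at ht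
    change n ≤ supDist (manhattanWalk (fun y => e.horiz (y + o.2)) (fun x => e.vert (x + o.1)) 0 t) 0
    simpa [supDist] using ht
  have h1 : coinMeasure (crossingSet n ∪ CoinSpace.reflect ⁻¹' crossingSet n) ≤
      2 * coinMeasure (crossingSet n) := by
    rw [two_mul]
    exact (measure_union_le _ _).trans (add_le_add le_rfl (coinMeasure_reflect_le _))
  calc coinMeasure (exitSet o n) ≤ coinMeasure (exitSet 0 n) :=
        (measure_mono h0).trans (coinMeasure_shift_le o _)
    _ ≤ 2 * coinMeasure (crossingSet n) + 2 * coinMeasure (crossingSet n) :=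
        (measure_mono (exitSet_zero_subset n)).trans ((measure_union_le _ _).trans
          (add_le_add h1 ((coinMeasure_swap_le _).trans h1)))
    _ = 4 * coinMeasure (crossingSet n) := by rw [← add_mul]; norm_num

/-! ### Escape of the component -/

/-- Out-degree one makes the walks from adjacent vertices coalesce, and coalescence propagates along
undirected paths. -/
lemma exists_manhattanWalk_eq_of_mem_component {U V : ℤ → ℤ} {o u : ℤ × ℤ}
    (h : u ∈ manhattanComponent U V o) : ∃ s t, manhattanWalk U V u s = manhattanWalk U V o t := by
  have hr : (manhattanGraph U V).Reachable u o := SimpleGraph.ConnectedComponent.exact h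
  obtain ⟨w⟩ := hr
  induction w with
  | nil => exact ⟨0, 0, rfl⟩
  | @cons a b c hab _ ih =>
    obtain ⟨s, t, hst⟩ := ih (by rename_i p; exact SimpleGraph.ConnectedComponent.sound ⟨p⟩)
    rcases ((SimpleGraph.fromRel_adj _ _ _).1 hab).2 with h | h
    · refine ⟨s + 1, t, ?_⟩
      rw [← hst, manhattanWalk_add, h]
      rfl
    · refine ⟨s, t + 1, ?_⟩
      rw [manhattanWalk_succ, ← hst, ← manhattanWalk_succ, manhattanWalk_add, h]
      rfl

/-- The distance to `o` changes by at most one along each edge of a path to `o`. Having a vertex at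
distance exactly `m` confines the later union bound to a fixed box. -/
lemma exists_mem_component_supDist_eq {U V : ℤ → ℤ} (hU : ∀ y, U y = 1 ∨ U y = -1)
    (hV : ∀ x, V x = 1 ∨ V x = -1) {o u : ℤ × ℤ} (h : u ∈ manhattanComponent U V o) {m : ℕ}
    (hm : m ≤ supDist u o) : ∃ v ∈ manhattanComponent U V o, supDist v o = m := by
  have hr : (manhattanGraph U V).Reachable u o := SimpleGraph.ConnectedComponent.exact h
  obtain ⟨w⟩ := hr
  induction w with
  | nil => exact ⟨_, h, by simp [supDist] at hm ⊢; omega⟩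
  | @cons a b c hab p ih =>
    rcases hm.eq_or_lt with he | hlt
    · exact ⟨a, h, he.symm⟩
    · refine ih (SimpleGraph.ConnectedComponent.sound ⟨p⟩) ?_
      rcases ((SimpleGraph.fromRel_adj _ _ _).1 hab).2 with h | h
      · have := (supDist_manhattanStep_le hU hV a c).2
        rw [← h] at this
        omega
      · have := (supDist_manhattanStep_le hU hV b c).1
        rw [← h] at this
        omega

/-- The environments in which the component of `o` contains a vertex at distance at least `m`
from `o`. -/
def escapeSet (o : ℤ × ℤ) (m : ℕ) : Set CoinSpace :=
  {e | ∃ u ∈ manhattanComponent e.horiz e.vert o, m ≤ supDist u o}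

lemma coinMeasure_escapeSet_le (o : ℤ × ℤ) (r : ℕ) :
    coinMeasure (escapeSet o (2 * r)) ≤
      ((4 * r + 1) ^ 2 : ℕ) * (4 * coinMeasure (crossingSet r)) := by
  set B := Finset.Icc (o.1 - 2 * r) (o.1 + 2 * r) ×ˢ Finset.Icc (o.2 - 2 * r) (o.2 + 2 * r) with hB
  have hmem : ∀ u, supDist u o ≤ 2 * r → u ∈ B := by
    intro u hu
    simp only [supDist] at hu
    simp only [hB, Finset.mem_product, Finset.mem_Icc]
    omega
  have hcard : B.card = (4 * r + 1) ^ 2 := by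
    rw [hB, Finset.card_product, Int.card_Icc, Int.card_Icc, sq]
    congr 1 <;> omega
  have hsub : escapeSet o (2 * r) ⊆ ⋃ u ∈ B, exitSet u r := by
    rintro e ⟨u', hu', hm⟩
    obtain ⟨u, hu, hur⟩ := exists_mem_component_supDist_eq e.horiz_values e.vert_values hu' hm
    obtain ⟨s, t, hst⟩ := exists_manhattanWalk_eq_of_mem_component hu
    simp only [Set.mem_iUnion]
    -- The meeting point of the two walks is at distance at least `r` from `o` or from `u`, as these
    -- are `2r` apart.
    by_cases h : r ≤ supDist (manhattanWalk e.horiz e.vert o t) o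
    · exact ⟨o, hmem o (by simp [supDist]), t, h⟩
    · refine ⟨u, hmem u hur.le, s, ?_⟩
      rw [hst]
      simp only [supDist] at h hur ⊢
      omega
  calc coinMeasure (escapeSet o (2 * r)) ≤ ∑ u ∈ B, coinMeasure (exitSet u r) :=
        (measure_mono hsub).trans (measure_biUnion_finset_le _ _)
    _ ≤ ∑ u ∈ B, 4 * coinMeasure (crossingSet r) :=
        Finset.sum_le_sum fun u _ => coinMeasure_exitSet_le u r
    _ = _ := by rw [Finset.sum_const, hcard, nsmul_eq_mul]

/-! ### Lower bound: confinement in a strip -/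

/-- The displacement of a walk which crosses the columns `0, …, k - 1` from left to right. -/
def CoinSpace.drift (e : CoinSpace) (k : ℕ) : ℤ := ∑ j ∈ Finset.range k, e.vert j

/-- The environments in which the lines at height at most `w` in absolute value are oriented to the
right, and the displacement stays between `-w` and `w` during `k` steps. -/
def confinedSet (w k : ℕ) : Set CoinSpace :=
  {e | (∀ y ∈ Finset.Icc (-w : ℤ) w, e.horiz y = 1) ∧ ∀ j ≤ k, |e.drift j| ≤ w}

lemma CoinSpace.drift_succ (e : CoinSpace) (k : ℕ) :
    e.drift (k + 1) = e.drift k + e.vert k := Finset.sum_range_succ _ _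

lemma CoinSpace.drift_flip {e : CoinSpace} {j k : ℕ} (h : j ≤ k) :
    (e.flip k).drift j = e.drift j :=
  Finset.sum_congr rfl fun i hi => CoinSpace.vert_flip_of_ne
    (by have := Finset.mem_range.1 hi; omega) e

lemma CoinSpace.measurable_drift (k : ℕ) : Measurable fun e : CoinSpace => e.drift k :=
  Finset.measurable_fun_sum _ fun _ _ => CoinSpace.measurable_vert _

lemma measurableSet_confinedSet (w k : ℕ) : MeasurableSet (confinedSet w k) := by
  have := (MeasurableSet.iInter fun y : ℤ => MeasurableSet.iInter
    fun _ : y ∈ Finset.Icc (-w : ℤ) w =>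
      (CoinSpace.measurable_horiz y (measurableSet_singleton 1))).inter
    (MeasurableSet.iInter fun j : ℕ => MeasurableSet.iInter fun _ : j ≤ k =>
      (CoinSpace.measurable_drift j ({x : ℤ | |x| ≤ w}.to_countable.measurableSet)))
  convert this using 1
  ext e
  simp [confinedSet]

lemma coinMeasure_confinedSet_zero (w : ℕ) :
    coinMeasure (confinedSet w 0) = 2⁻¹ ^ (2 * w + 1) := by
  have h := coinMeasure_cylinder ((Finset.Icc (-w : ℤ) w).image Sum.inl) fun _ => true
  rw [Finset.card_image_of_injective _ Sum.inl_injective, Int.card_Icc] at h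
  have e1 : ((w : ℤ) + 1 - -w).toNat = 2 * w + 1 := by omega
  rw [e1] at h
  rw [← h]
  congr 1
  ext e
  simp only [confinedSet, Finset.mem_Icc, Set.mem_ofPred_eq, Finset.mem_image]
  constructor
  · rintro ⟨h, -⟩ _ ⟨y, hy, rfl⟩
    have := h y hy
    by_contra hc
    simp [CoinSpace.horiz, boolSign, hc] at this
  · intro h
    refine ⟨fun y hy => ?_, fun j hj => ?_⟩
    · simp [CoinSpace.horiz, boolSign, h _ ⟨y, hy, rfl⟩]
    · obtain rfl := Nat.le_zero.1 hj
      simp [CoinSpace.drift]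

/-- The first Dirichlet eigenfunction of the simple random walk between `-w` and `w`, evaluated at the
displacement, on the event of confinement. -/
noncomputable def confinedWeight (w k : ℕ) : CoinSpace → ℝ≥0∞ :=
  (confinedSet w k).indicator
    fun e => ENNReal.ofReal (Real.cos (Real.pi / (2 * (w + 1)) * e.drift k))

lemma measurable_confinedWeight (w k : ℕ) : Measurable (confinedWeight w k) := by
  refine Measurable.indicator ?_ (measurableSet_confinedSet w k)
  have : Measurable fun x : ℤ => ENNReal.ofReal (Real.cos (Real.pi / (2 * (w + 1)) * x)) :=
    measurable_of_countable _
  exact this.comp (CoinSpace.measurable_drift k)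

/-- The cosine vanishes at `±(w + 1)`, so a step that leaves the strip loses nothing. -/
lemma ofReal_cos_le_confinedWeight_succ {w k : ℕ} {e : CoinSpace} (he : e ∈ confinedSet w k) :
    ENNReal.ofReal (Real.cos (Real.pi / (2 * (w + 1)) * (e.drift k + e.vert k : ℤ))) ≤
      confinedWeight w (k + 1) e := by
  by_cases h : |e.drift (k + 1)| ≤ w
  · have hmem : e ∈ confinedSet w (k + 1) := by
      refine ⟨he.1, fun j hj => ?_⟩
      rcases Nat.le_succ_iff.1 hj with hj | rfl
      · exact he.2 j hj
      · exact h
    rw [confinedWeight, Set.indicator_of_mem hmem, CoinSpace.drift_succ]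
  · rw [CoinSpace.drift_succ] at h
    have h1 := abs_le.1 (he.2 k le_rfl)
    have hcases : e.drift k + e.vert k = w + 1 ∨ e.drift k + e.vert k = -(w + 1) := by
      rw [abs_le] at h
      rcases e.vert_values k with h2 | h2 <;> rw [h2] at h ⊢ <;> omega
    have hw : (0 : ℝ) < w + 1 := by positivity
    have hz : Real.cos (Real.pi / (2 * (w + 1)) * (e.drift k + e.vert k : ℤ)) = 0 := by
      rcases hcases with h2 | h2 <;> rw [h2]
      · rw [← Real.cos_pi_div_two]
        congr 1
        push_cast
        field_simp
      · rw [← Real.cos_pi_div_two, ← Real.cos_neg (Real.pi / 2)]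
        congr 1
        push_cast
        field_simp
    rw [hz]
    simp

/-- With `θ = π/(2(w+1))`, this is `cos(θ(x+1)) + cos(θ(x-1)) = 2 cos θ cos(θx)`. -/
lemma confinedWeight_add_flip_ge (w k : ℕ) (e : CoinSpace) :
    2 * ENNReal.ofReal (Real.cos (Real.pi / (2 * (w + 1)))) * confinedWeight w k e ≤
      confinedWeight w (k + 1) e + confinedWeight w (k + 1) (e.flip k) := by
  by_cases he : e ∈ confinedSet w k
  swap
  · rw [confinedWeight, Set.indicator_of_notMem he]
    simp
  have he' : e.flip k ∈ confinedSet w k := by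
    refine ⟨fun y hy => ?_, fun j hj => ?_⟩
    · rw [CoinSpace.horiz_flip]; exact he.1 y hy
    · rw [CoinSpace.drift_flip hj]; exact he.2 j hj
  have h1 := ofReal_cos_le_confinedWeight_succ he
  have h2 := ofReal_cos_le_confinedWeight_succ he'
  rw [CoinSpace.drift_flip le_rfl, CoinSpace.vert_flip_self] at h2
  refine le_trans ?_ (add_le_add h1 h2)
  refine le_trans ?_ ENNReal.ofReal_add_le
  rw [confinedWeight, Set.indicator_of_mem he]
  set θ := Real.pi / (2 * ((w : ℝ) + 1)) with hθ
  have hpos : 0 ≤ Real.cos θ := by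
    apply Real.cos_nonneg_of_neg_pi_div_two_le_of_le
    · have : 0 ≤ θ := by positivity
      linarith [Real.pi_pos]
    · rw [hθ]
      apply div_le_div_of_nonneg_left Real.pi_pos.le (by norm_num)
      have : (0 : ℝ) ≤ w := by positivity
      linarith
  have e2 : (2 : ℝ≥0∞) = ENNReal.ofReal 2 := by simp
  rw [e2, ← ENNReal.ofReal_mul (by norm_num), ← ENNReal.ofReal_mul (by linarith)]
  apply ENNReal.ofReal_le_ofReal
  apply le_of_eq
  rcases e.vert_values k with h3 | h3 <;> rw [h3] <;> push_cast <;>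
    simp only [mul_add, mul_neg, mul_one, Real.cos_add, Real.cos_neg, Real.sin_neg] <;> ring

lemma confinedSet_measure_ge (w k : ℕ) :
    ENNReal.ofReal (Real.cos (Real.pi / (2 * (w + 1)))) ^ k * 2⁻¹ ^ (2 * w + 1) ≤
      coinMeasure (confinedSet w k) := by
  have key : ∀ k, ENNReal.ofReal (Real.cos (Real.pi / (2 * (w + 1)))) ^ k * 2⁻¹ ^ (2 * w + 1) ≤
      ∫⁻ e, confinedWeight w k e ∂coinMeasure := by
    intro k
    induction k with
    | zero =>
      rw [pow_zero, one_mul, ← coinMeasure_confinedSet_zero,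
        ← lintegral_indicator_one (measurableSet_confinedSet w 0)]
      refine lintegral_mono fun e => ?_
      by_cases h : e ∈ confinedSet w 0
      · rw [confinedWeight, Set.indicator_of_mem h, Set.indicator_of_mem h]
        simp [CoinSpace.drift]
      · rw [Set.indicator_of_notMem h]
        exact zero_le
    | succ k ih =>
      set ρ := ENNReal.ofReal (Real.cos (Real.pi / (2 * (w + 1)))) with hρ
      have h1 : 2 * (ρ * ∫⁻ e, confinedWeight w k e ∂coinMeasure) ≤
          2 * ∫⁻ e, confinedWeight w (k + 1) e ∂coinMeasure := by
        rw [two_mul_lintegral_eq_flip k (measurable_confinedWeight w (k + 1)), ← mul_assoc,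
          ← lintegral_const_mul' _ _ (ENNReal.mul_ne_top (by norm_num) ENNReal.ofReal_ne_top)]
        exact lintegral_mono fun e => confinedWeight_add_flip_ge w k e
      have h2 := (ENNReal.mul_le_mul_iff_right (by norm_num) (by norm_num)).1 h1
      calc ρ ^ (k + 1) * 2⁻¹ ^ (2 * w + 1) = ρ * (ρ ^ k * 2⁻¹ ^ (2 * w + 1)) := by ring
        _ ≤ ρ * ∫⁻ e, confinedWeight w k e ∂coinMeasure := by gcongr
        _ ≤ _ := h2
  refine (key k).trans ?_
  rw [← lintegral_indicator_one (measurableSet_confinedSet w k)]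
  refine lintegral_mono fun e => ?_
  refine Set.indicator_le_indicator ?_
  simpa using Real.cos_le_one _

lemma manhattanWalk_of_mem_confinedSet {w k : ℕ} {e : CoinSpace} (he : e ∈ confinedSet w k) :
    ∀ t ≤ k, manhattanWalk e.horiz e.vert 0 t = ((t : ℤ), e.drift t) := by
  intro t
  induction t with
  | zero => intro _; simp [manhattanWalk_zero, CoinSpace.drift]; rfl
  | succ t ih =>
    intro ht
    rw [manhattanWalk_succ, ih (by omega), manhattanStep, CoinSpace.drift_succ]
    simp only
    rw [he.1 _ (Finset.mem_Icc.2 (abs_le.1 (he.2 t (by omega))))]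
    push_cast
    rfl

/-- The environments in which the walk started at `o` moves to the right at the times `0, …, N`. -/
def straightSet (o : ℤ × ℤ) (N : ℕ) : Set CoinSpace :=
  {e | ∀ t ≤ N, e.horiz (manhattanWalk e.horiz e.vert o t).2 = 1}

lemma measurableSet_straightSet (o : ℤ × ℤ) (N : ℕ) : MeasurableSet (straightSet o N) := by
  have h : Measurable fun q : CoinSpace × (ℤ × ℤ) => q.1.horiz q.2.2 :=
    measurable_from_prod_countable_left fun v => CoinSpace.measurable_horiz v.2
  have := MeasurableSet.iInter fun t : ℕ => MeasurableSet.iInter fun _ : t ≤ N =>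
    (h.comp (measurable_id.prodMk (measurable_coinWalk o t))) (measurableSet_singleton 1)
  convert this using 1
  ext e
  simp [straightSet]

lemma coinMeasure_straightSet_ge (o : ℤ × ℤ) (w N : ℕ) :
    ENNReal.ofReal (Real.cos (Real.pi / (2 * (w + 1)))) ^ N * 2⁻¹ ^ (2 * w + 1) ≤
      coinMeasure (straightSet o N) := by
  refine (confinedSet_measure_ge w N).trans ?_
  rw [← coinMeasure_map_shift o,
    Measure.map_apply (CoinSpace.measurable_shift o) (measurableSet_confinedSet w N),
    coinMeasure_map_shift o]
  refine measure_mono fun e he t ht => ?_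
  have h1 := manhattanWalk_of_mem_confinedSet he t ht
  rw [manhattanWalk_shift]
  change e.horiz (o.2 + (manhattanWalk (e.shift o).horiz (e.shift o).vert 0 t).2) = 1
  rw [h1, add_comm]
  exact he.1 _ (Finset.mem_Icc.2 (abs_le.1 (he.2 t ht)))

/-! ### Straight paths, lineage and component -/

section

variable {U V : ℤ → ℤ} {o : ℤ × ℤ} {N t : ℕ}

lemma manhattanWalk_fst_of_straight (h : ∀ t ≤ N, U (manhattanWalk U V o t).2 = 1) :
    ∀ t ≤ N, (manhattanWalk U V o t).1 = o.1 + t := by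
  intro t
  induction t with
  | zero => intro _; simp [manhattanWalk_zero]
  | succ t ih =>
    intro ht
    rw [manhattanWalk_succ, manhattanStep]
    simp only
    rw [ih (by omega), h t (by omega)]
    push_cast
    ring

/-- Every intermediate vertex is followed by two steps to the right, so its successor does not lead
back to it and it is no trap. -/
lemma manhattanWalk_mem_lineage (h : ∀ t ≤ N, U (manhattanWalk U V o t).2 = 1) (ht : t ≤ N) :
    manhattanWalk U V o t ∈ manhattanLineage U V o := by
  refine Or.inr ⟨t, manhattanWalk U V o, rfl, rfl, fun k _ => manhattanWalk_succ U V o k, ?_⟩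
  rintro k - hk ⟨v, hv, hv'⟩
  rw [ManhattanEdge, ← manhattanWalk_succ] at hv
  rw [ManhattanEdge, hv, ← manhattanWalk_succ] at hv'
  have h1 := congrArg Prod.fst hv'
  rw [manhattanWalk_succ _ _ _ (k + 1), manhattanStep] at h1
  simp only at h1
  rw [h (k + 1) (by omega), manhattanWalk_fst_of_straight h k (by omega),
    manhattanWalk_fst_of_straight h (k + 1) (by omega)] at h1
  push_cast at h1
  omega

lemma manhattanGraph_adj_step (hU : ∀ y, U y = 1 ∨ U y = -1) {v : ℤ × ℤ} :
    (manhattanGraph U V).Adj v (manhattanStep U V v) := by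
  refine (SimpleGraph.fromRel_adj _ _ _).2 ⟨fun hc => ?_, Or.inl rfl⟩
  have := congrArg Prod.fst hc
  simp only [manhattanStep] at this
  rcases hU v.2 with h | h <;> rw [h] at this <;> omega

lemma Leads.reachable (hU : ∀ y, U y = 1 ∨ U y = -1) {a b : ℤ × ℤ} (h : Leads U V a b) :
    (manhattanGraph U V).Reachable a b := by
  obtain ⟨n, p, rfl, rfl, hp, -⟩ := h
  have key : ∀ k ≤ n, (manhattanGraph U V).Reachable (p 0) (p k) := by
    intro k
    induction k with
    | zero => intro _; exact SimpleGraph.Reachable.refl _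
    | succ k ih =>
      intro hk
      refine (ih (by omega)).trans (SimpleGraph.Adj.reachable ?_)
      rw [hp k (by omega)]
      exact manhattanGraph_adj_step hU
  exact key n le_rfl

lemma manhattanLineage_subset_component (hU : ∀ y, U y = 1 ∨ U y = -1) :
    manhattanLineage U V o ⊆ manhattanComponent U V o := by
  rintro u (h | h)
  · exact SimpleGraph.ConnectedComponent.sound (h.reachable hU)
  · exact SimpleGraph.ConnectedComponent.sound (h.reachable hU).symm

end

/-! ### Diameter and cardinality -/

lemma latticeDiam_mono {S T : Set (ℤ × ℤ)} (h : S ⊆ T) : latticeDiam S ≤ latticeDiam T :=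
  Metric.ediam_mono (Set.image_mono h)

lemma latticeCard_mono {S T : Set (ℤ × ℤ)} (h : S ⊆ T) : latticeCard S ≤ latticeCard T := by
  unfold latticeCard
  exact_mod_cast Set.encard_le_encard h

lemma abs_sub_fst_le_latticeDiam {S : Set (ℤ × ℤ)} {u v : ℤ × ℤ} (hu : u ∈ S) (hv : v ∈ S) :
    ENNReal.ofReal |(u.1 : ℝ) - v.1| ≤ latticeDiam S := by
  refine le_trans ?_ (Metric.edist_le_ediam_of_mem (Set.mem_image_of_mem _ hu)
    (Set.mem_image_of_mem _ hv))
  rw [edist_dist]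
  apply ENNReal.ofReal_le_ofReal
  rw [EuclideanSpace.dist_eq, Fin.sum_univ_two]
  apply Real.le_sqrt_of_sq_le
  simp [Real.dist_eq]
  positivity

lemma latticeDiam_le_of_supDist_le {S : Set (ℤ × ℤ)} {o : ℤ × ℤ} {m : ℕ}
    (h : ∀ u ∈ S, supDist u o ≤ m) : latticeDiam S ≤ (3 * m : ℕ) := by
  refine Metric.ediam_le ?_
  rintro _ ⟨u, hu, rfl⟩ _ ⟨v, hv, rfl⟩
  rw [edist_dist, ← ENNReal.ofReal_natCast]
  apply ENNReal.ofReal_le_ofReal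
  rw [EuclideanSpace.dist_eq, Fin.sum_univ_two]
  have h1 := h u hu
  have h2 := h v hv
  simp only [supDist] at h1 h2
  have a1 : |u.1 - v.1| ≤ 2 * m := by rw [abs_le]; omega
  have a2 : |u.2 - v.2| ≤ 2 * m := by rw [abs_le]; omega
  have b1 : |(u.1 : ℝ) - v.1| ≤ 2 * m := by exact_mod_cast a1
  have b2 : |(u.2 : ℝ) - v.2| ≤ 2 * m := by exact_mod_cast a2
  -- Both coordinates differ by at most `2m`, and `(2m)² + (2m)² ≤ (3m)²`.
  rw [Real.sqrt_le_left (by positivity)]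
  simp only [Real.dist_eq, Matrix.cons_val_zero, Matrix.cons_val_one]
  push_cast
  nlinarith [abs_nonneg ((u.1 : ℝ) - v.1), abs_nonneg ((u.2 : ℝ) - v.2)]

lemma latticeCard_le_of_supDist_le {S : Set (ℤ × ℤ)} {o : ℤ × ℤ} {m : ℕ}
    (h : ∀ u ∈ S, supDist u o ≤ m) : latticeCard S ≤ ((2 * m + 1) ^ 2 : ℕ) := by
  set B := Finset.Icc (o.1 - m) (o.1 + m) ×ˢ Finset.Icc (o.2 - m) (o.2 + m) with hB
  have hcard : B.card = (2 * m + 1) ^ 2 := by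
    rw [hB, Finset.card_product, Int.card_Icc, Int.card_Icc, sq]
    congr 1 <;> omega
  have hsub : S ⊆ (B : Set (ℤ × ℤ)) := by
    intro u hu
    have := h u hu
    simp only [supDist] at this
    simp only [hB, Finset.coe_product, Finset.coe_Icc, Set.mem_prod, Set.mem_Icc]
    omega
  refine (latticeCard_mono hsub).trans ?_
  rw [latticeCard, Set.encard_coe_eq_coe_finsetCard, hcard]
  simp

lemma lt_latticeDiam_lineage_of_straight {U V : ℤ → ℤ} {o : ℤ × ℤ} {n : ℕ}
    (h : ∀ t ≤ n + 1, U (manhattanWalk U V o t).2 = 1) :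
    (n : ℝ≥0∞) < latticeDiam (manhattanLineage U V o) := by
  refine lt_of_lt_of_le ?_ (abs_sub_fst_le_latticeDiam
    (manhattanWalk_mem_lineage h le_rfl) (manhattanWalk_mem_lineage h (Nat.zero_le _)))
  rw [manhattanWalk_fst_of_straight h _ le_rfl, manhattanWalk_fst_of_straight h _ (Nat.zero_le _),
    ← ENNReal.ofReal_natCast]
  apply (ENNReal.ofReal_lt_ofReal_iff_of_nonneg (by positivity)).2
  push_cast
  refine lt_of_lt_of_le ?_ (le_abs_self _)
  linarith

lemma lt_latticeCard_lineage_of_straight {U V : ℤ → ℤ} {o : ℤ × ℤ} {n : ℕ}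
    (h : ∀ t ≤ n + 1, U (manhattanWalk U V o t).2 = 1) :
    (n : ℝ≥0∞) < latticeCard (manhattanLineage U V o) := by
  set B := (Finset.range (n + 2)).image (manhattanWalk U V o) with hB
  have hcard : B.card = n + 2 := by
    rw [hB, Finset.card_image_of_injOn, Finset.card_range]
    intro a ha b hb hab
    rw [Finset.coe_range, Set.mem_Iio] at ha hb
    have := congrArg Prod.fst hab
    rw [manhattanWalk_fst_of_straight h a (by omega),
      manhattanWalk_fst_of_straight h b (by omega)] at this
    omega
  have hsub : (B : Set (ℤ × ℤ)) ⊆ manhattanLineage U V o := by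
    intro u hu
    obtain ⟨t, ht, rfl⟩ := Finset.mem_image.1 (Finset.mem_coe.1 hu)
    exact manhattanWalk_mem_lineage h (by have := Finset.mem_range.1 ht; omega)
  refine lt_of_lt_of_le ?_ (latticeCard_mono hsub)
  rw [latticeCard, Set.encard_coe_eq_coe_finsetCard, hcard]
  push_cast
  exact_mod_cast (by omega : n < n + 2)

/-! ### Numerical estimates -/

lemma exists_mul_pow_le_lt {K d : ℕ} (hK : 1 ≤ K) (hd : d ≠ 0) (n : ℕ) :
    ∃ q, K * q ^ d ≤ n ∧ n < K * (q + 1) ^ d := by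
  have hex : ∃ p, n < K * (p + 1) ^ d := by
    refine ⟨n, ?_⟩
    calc n < n + 1 := Nat.lt_succ_self n
      _ ≤ (n + 1) ^ d := Nat.le_self_pow hd _
      _ ≤ K * (n + 1) ^ d := Nat.le_mul_of_pos_left _ hK
  classical
  refine ⟨Nat.find hex, ?_, Nat.find_spec hex⟩
  rcases hc : Nat.find hex with _ | p
  · simp [hd]
  · exact not_lt.1 (Nat.find_min hex (by omega : p < Nat.find hex))

/-- The exponent `(q^4 - 1)/(5q²)` is at least `q/5 - 1/5`, and `e^(1/5) ≤ 2`. -/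
lemma one_sub_inv_pow_le {q : ℕ} (hq : 1 ≤ q) :
    (1 - 1 / (5 * (q : ℝ) ^ 2)) ^ (q ^ 4 - 1) ≤ 2 * Real.exp (-(q / 5)) := by
  have hq' : (1 : ℝ) ≤ q := by exact_mod_cast hq
  have hle : 1 / (5 * (q : ℝ) ^ 2) ≤ 1 / 5 := by
    apply one_div_le_one_div_of_le (by norm_num)
    nlinarith
  have h1 : 1 - 1 / (5 * (q : ℝ) ^ 2) ≤ Real.exp (-(1 / (5 * (q : ℝ) ^ 2))) := by
    linarith [Real.add_one_le_exp (-(1 / (5 * (q : ℝ) ^ 2)))]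
  have hcast : ((q ^ 4 - 1 : ℕ) : ℝ) = (q : ℝ) ^ 4 - 1 := by
    rw [Nat.cast_sub (Nat.one_le_pow _ _ hq)]
    push_cast
    ring
  have h2 : Real.exp (1 / 5) ≤ 2 := by
    have h3 := Real.add_one_le_exp (-(1 / 5) : ℝ)
    have h4 : Real.exp (1 / 5) * Real.exp (-(1 / 5)) = 1 := by rw [← Real.exp_add]; norm_num
    nlinarith [Real.exp_pos (1 / 5 : ℝ)]
  calc (1 - 1 / (5 * (q : ℝ) ^ 2)) ^ (q ^ 4 - 1)
      ≤ Real.exp (-(1 / (5 * (q : ℝ) ^ 2))) ^ (q ^ 4 - 1) :=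
        pow_le_pow_left₀ (by linarith) h1 _
    _ = Real.exp (-((q : ℝ) ^ 2 / 5) + 1 / (5 * (q : ℝ) ^ 2)) := by
        rw [← Real.exp_nat_mul, hcast]
        congr 1
        field_simp
        ring
    _ ≤ Real.exp (1 / 5 + -(q / 5)) := by
        apply Real.exp_le_exp.2
        nlinarith
    _ ≤ 2 * Real.exp (-(q / 5)) := by
        rw [Real.exp_add]
        gcongr

/-- A multiplicative constant for the upper tail bounds. -/
noncomputable def tailConstant : ℝ := 600 * (10 ^ 12 * (Nat.factorial 12 : ℝ))

lemma one_le_tailConstant : 1 ≤ tailConstant := by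
  unfold tailConstant
  norm_num [Nat.factorial]

/-- The box and the crossing bound give at most `25 * 4 * 6 * q^12 * e^(-q/5)`. Half of the
exponential absorbs the polynomial, since `q^12 * e^(-q/10) ≤ 10^12 * 12!`. -/
lemma coinMeasure_escapeSet_le_exp (o : ℤ × ℤ) (q : ℕ) :
    coinMeasure (escapeSet o (2 * q ^ 4)) ≤
      ENNReal.ofReal (tailConstant * Real.exp (-(q / 10))) := by
  rcases Nat.eq_zero_or_pos q with rfl | hq
  · refine prob_le_one.trans ?_
    rw [← ENNReal.ofReal_one]
    apply ENNReal.ofReal_le_ofReal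
    simpa using one_le_tailConstant
  have hq' : (1 : ℝ) ≤ q := by exact_mod_cast hq
  have h1 := coinMeasure_escapeSet_le o (q ^ 4)
  have h2 := coinMeasure_crossingSet_le (q ^ 4) q (Nat.one_le_pow _ _ hq) hq
  have hle : 1 / (5 * (q : ℝ) ^ 2) ≤ 1 / 5 := by
    apply one_div_le_one_div_of_le (by norm_num)
    nlinarith
  have hhalf : (1 / 2 : ℝ) ^ q ≤ Real.exp (-(q / 5)) := by
    have : (1 / 2 : ℝ) ≤ Real.exp (-(1 / 5)) := by linarith [Real.add_one_le_exp (-(1 / 5) : ℝ)]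
    calc (1 / 2 : ℝ) ^ q ≤ Real.exp (-(1 / 5)) ^ q := pow_le_pow_left₀ (by norm_num) this _
      _ = _ := by rw [← Real.exp_nat_mul]; congr 1; ring
  have hpow4 : (1 : ℝ) ≤ (q : ℝ) ^ 4 := one_le_pow₀ hq'
  have h3 : coinMeasure (crossingSet (q ^ 4)) ≤
      ENNReal.ofReal (6 * (q : ℝ) ^ 4 * Real.exp (-(q / 5))) := by
    refine h2.trans ?_
    have e1 : (2⁻¹ : ℝ≥0∞) = ENNReal.ofReal (1 / 2) := by
      rw [one_div, ENNReal.ofReal_inv_of_pos (by norm_num)]; simp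
    rw [e1, ← ENNReal.ofReal_pow (by norm_num), ← ENNReal.ofReal_pow (by linarith),
      ← ENNReal.ofReal_natCast, ← ENNReal.ofReal_mul (by positivity),
      ← ENNReal.ofReal_mul (by norm_num),
      ← ENNReal.ofReal_add (by positivity) (mul_nonneg (by norm_num) (pow_nonneg (by linarith) _))]
    apply ENNReal.ofReal_le_ofReal
    have h4 := one_sub_inv_pow_le hq
    push_cast
    have h5 : (2 * (q : ℝ) ^ 4 + 1) * (1 / 2) ^ q ≤ 3 * (q : ℝ) ^ 4 * Real.exp (-(q / 5)) := by
      gcongr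
      linarith
    have h6 : Real.exp (-(q / 5 : ℝ)) ≤ (q : ℝ) ^ 4 * Real.exp (-(q / 5)) :=
      le_mul_of_one_le_left (Real.exp_pos _).le hpow4
    refine (add_le_add h5 (mul_le_mul_of_nonneg_left h4 (by norm_num))).trans ?_
    linarith [Real.exp_pos (-(q / 5 : ℝ))]
  calc coinMeasure (escapeSet o (2 * q ^ 4))
      ≤ ((4 * q ^ 4 + 1) ^ 2 : ℕ) *
          (4 * ENNReal.ofReal (6 * (q : ℝ) ^ 4 * Real.exp (-(q / 5)))) := h1.trans (by gcongr)
    _ = ENNReal.ofReal (((4 * q ^ 4 + 1) ^ 2 : ℕ) *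
          (4 * (6 * (q : ℝ) ^ 4 * Real.exp (-(q / 5))))) := by
        rw [ENNReal.ofReal_mul (p := (((4 * q ^ 4 + 1) ^ 2 : ℕ) : ℝ)) (by positivity),
          ENNReal.ofReal_mul (p := 4) (by norm_num), ENNReal.ofReal_natCast]
        simp
    _ ≤ _ := by
        apply ENNReal.ofReal_le_ofReal
        have h7 := Real.pow_div_factorial_le_exp (x := (q : ℝ) / 10) (by positivity) 12
        rw [div_le_iff₀ (by positivity)] at h7
        have h8 : Real.exp (-(q / 5 : ℝ)) = Real.exp (-(q / 10)) * Real.exp (-(q / 10)) := by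
          rw [← Real.exp_add]; congr 1; ring
        have h9 : Real.exp (q / 10 : ℝ) * Real.exp (-(q / 10)) = 1 := by
          rw [← Real.exp_add]; simp
        have h10 : (q : ℝ) ^ 12 * Real.exp (-(q / 10)) ≤ 10 ^ 12 * (Nat.factorial 12 : ℝ) := by
          calc (q : ℝ) ^ 12 * Real.exp (-(q / 10))
              = 10 ^ 12 * ((q / 10) ^ 12 * Real.exp (-(q / 10))) := by ring
            _ ≤ 10 ^ 12 * (Real.exp (q / 10) * (Nat.factorial 12 : ℝ) * Real.exp (-(q / 10))) := by
                gcongr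
            _ = 10 ^ 12 * ((Nat.factorial 12 : ℝ) * (Real.exp (q / 10) * Real.exp (-(q / 10)))) := by
                ring
            _ = _ := by rw [h9, mul_one]
        push_cast
        calc (4 * (q : ℝ) ^ 4 + 1) ^ 2 * (4 * (6 * (q : ℝ) ^ 4 * Real.exp (-(q / 5))))
            ≤ (5 * (q : ℝ) ^ 4) ^ 2 * (4 * (6 * (q : ℝ) ^ 4 * Real.exp (-(q / 5)))) := by
              gcongr
              linarith
          _ = 600 * ((q : ℝ) ^ 12 * Real.exp (-(q / 10))) * Real.exp (-(q / 10)) := by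
              rw [h8]; ring
          _ ≤ 600 * (10 ^ 12 * (Nat.factorial 12 : ℝ)) * Real.exp (-(q / 10)) := by gcongr
          _ = _ := by rw [tailConstant]

lemma rpow_one_div_le {n q d K : ℕ} (hd : d ≠ 0) (hK : K ≤ 2 ^ d) (h : n < K * (q + 1) ^ d) :
    (n : ℝ) ^ (1 / d : ℝ) ≤ 2 * (q + 1) := by
  have h1 : n ≤ (2 * (q + 1)) ^ d := by
    rw [mul_pow]
    exact h.le.trans (Nat.mul_le_mul_right _ hK)
  have h2 : (n : ℝ) ≤ (2 * ((q : ℝ) + 1)) ^ d := by exact_mod_cast h1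
  calc (n : ℝ) ^ (1 / d : ℝ) ≤ ((2 * ((q : ℝ) + 1)) ^ d) ^ (1 / d : ℝ) := by gcongr
    _ = _ := by rw [one_div, Real.pow_rpow_inv_natCast (by positivity) hd]

/-- From `n^(1/d) ≤ 2(q + 1)` one gets `q/10 ≥ n^(1/d)/20 - 1/10`, whence the rate 1/20 and the
factor `e^(1/10)`. -/
lemma tail_exp_le {n q d K : ℕ} (hd : d ≠ 0) (hK : K ≤ 2 ^ d) (h : n < K * (q + 1) ^ d) :
    tailConstant * Real.exp (-(q / 10)) ≤
      tailConstant * Real.exp (1 / 10) * Real.exp (-(1 / 20) * (n : ℝ) ^ (1 / d : ℝ)) := by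
  have h1 := rpow_one_div_le hd hK h
  rw [mul_assoc, ← Real.exp_add]
  have := one_le_tailConstant
  gcongr
  linarith

lemma exp_neg_le_cos {x : ℝ} (hx : 0 ≤ x) (hx1 : x ≤ 1) : Real.exp (-x ^ 2) ≤ Real.cos x := by
  refine le_trans ?_ (Real.one_sub_sq_div_two_le_cos)
  have h1 := Real.add_one_le_exp (x ^ 2)
  have h2 : Real.exp (x ^ 2) * Real.exp (-x ^ 2) = 1 := by rw [← Real.exp_add]; simp
  have h3 := Real.exp_pos (-x ^ 2)
  have h4 : x ^ 2 ≤ 1 := by nlinarith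
  nlinarith [sq_nonneg x]

lemma coinMeasure_straightSet_ge_exp (o : ℤ × ℤ) (n : ℕ) :
    ENNReal.ofReal (Real.exp (-9) * Real.exp (-6 * (n : ℝ) ^ (1 / 3 : ℝ))) ≤
      coinMeasure (straightSet o (n + 1)) := by
  set s : ℝ := ((n : ℝ) + 1) ^ (1 / 3 : ℝ) with hs
  have hs3 : s ^ 3 = n + 1 := by
    rw [hs, ← Real.rpow_natCast, ← Real.rpow_mul (by positivity)]
    norm_num
  have hs1 : 1 ≤ s := Real.one_le_rpow (by linarith [Nat.cast_nonneg (α := ℝ) n]) (by norm_num)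
  have hsn : s ≤ (n : ℝ) ^ (1 / 3 : ℝ) + 1 := by
    have := Real.rpow_add_le_add_rpow (p := 1 / 3) (Nat.cast_nonneg (α := ℝ) n) zero_le_one
      (by norm_num) (by norm_num)
    rwa [Real.one_rpow] at this
  set w := ⌈s⌉₊ with hw
  have hws : s ≤ w := Nat.le_ceil s
  have hws' : (w : ℝ) < s + 1 := Nat.ceil_lt_add_one (by linarith)
  refine le_trans ?_ (coinMeasure_straightSet_ge o w (n + 1))
  set x := Real.pi / (2 * ((w : ℝ) + 1)) with hx
  have hx0 : 0 ≤ x := by positivity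
  have hxs : x ≤ 2 / s := by
    rw [hx, div_le_div_iff₀ (by positivity) (by positivity)]
    nlinarith [Real.pi_le_four, Real.pi_pos]
  have hx1 : x ≤ 1 := by
    rw [hx, div_le_one (by positivity)]
    linarith [Real.pi_le_four]
  have hcos := exp_neg_le_cos hx0 hx1
  have e1 : (2⁻¹ : ℝ≥0∞) = ENNReal.ofReal (1 / 2) := by
    rw [one_div, ENNReal.ofReal_inv_of_pos (by norm_num)]; simp
  have hcos0 : 0 ≤ Real.cos x := (Real.exp_pos _).le.trans hcos
  rw [e1, ← ENNReal.ofReal_pow hcos0, ← ENNReal.ofReal_pow (by norm_num),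
    ← ENNReal.ofReal_mul (by positivity)]
  apply ENNReal.ofReal_le_ofReal
  have hhalf : Real.exp (-1) ≤ 1 / 2 := by
    rw [Real.exp_neg, one_div]
    exact inv_anti₀ (by norm_num) (by linarith [Real.add_one_le_exp (1 : ℝ)])
  have hxsq : ((n : ℝ) + 1) * x ^ 2 ≤ 4 * s := by
    rw [← hs3]
    calc s ^ 3 * x ^ 2 ≤ s ^ 3 * (2 / s) ^ 2 := by gcongr
      _ = 4 * s := by field_simp; norm_num
  -- Confinement costs at most `4s` in the exponent and the strip at most `2w + 1 ≤ 2s + 3`; as `s ≤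
  -- n^(1/3) + 1`, the total is at most `6 n^(1/3) + 9`.
  calc Real.exp (-9) * Real.exp (-6 * (n : ℝ) ^ (1 / 3 : ℝ))
      ≤ Real.exp (((n + 1 : ℕ) : ℝ) * (-x ^ 2) + ((2 * w + 1 : ℕ) : ℝ) * (-1)) := by
        rw [← Real.exp_add]
        apply Real.exp_le_exp.2
        push_cast
        nlinarith
    _ = Real.exp (-x ^ 2) ^ (n + 1) * Real.exp (-1) ^ (2 * w + 1) := by
        rw [Real.exp_add, Real.exp_nat_mul, Real.exp_nat_mul]
    _ ≤ Real.cos x ^ (n + 1) * (1 / 2) ^ (2 * w + 1) := by gcongr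

/-! ### Integrability from tails -/

lemma le_tsum_ite_lt (a : ℝ≥0∞) : a ≤ ∑' n : ℕ, if (n : ℝ≥0∞) < a then 1 else 0 := by
  refine ENNReal.le_of_forall_nnreal_lt fun r hr => ?_
  have hsub : ∀ n ∈ Finset.range ⌈r⌉₊, (n : ℝ≥0∞) < a := by
    intro n hn
    refine lt_trans ?_ hr
    exact_mod_cast Nat.lt_ceil.1 (Finset.mem_range.1 hn)
  calc (r : ℝ≥0∞) ≤ (⌈r⌉₊ : ℕ) := by exact_mod_cast Nat.le_ceil r
    _ = ∑ n ∈ Finset.range ⌈r⌉₊, if (n : ℝ≥0∞) < a then 1 else 0 := by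
        rw [Finset.sum_congr rfl fun n hn => if_pos (hsub n hn)]
        simp
    _ ≤ _ := ENNReal.sum_le_tsum _

/-- Measurable hulls of the superlevel sets make the exchange of sum and integral legitimate for
arbitrary `f`. -/
lemma lintegral_le_tsum_measure_lt {Ω : Type*} [MeasurableSpace Ω] (P : Measure Ω)
    (f : Ω → ℝ≥0∞) : ∫⁻ ω, f ω ∂P ≤ ∑' n : ℕ, P {ω | (n : ℝ≥0∞) < f ω} := by
  calc ∫⁻ ω, f ω ∂P
      ≤ ∫⁻ ω, ∑' n : ℕ, (toMeasurable P {ω | (n : ℝ≥0∞) < f ω}).indicator 1 ω ∂P := by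
        refine lintegral_mono fun ω => (le_tsum_ite_lt (f ω)).trans ?_
        refine ENNReal.tsum_le_tsum fun n => ?_
        split_ifs with h
        · rw [Set.indicator_of_mem (subset_toMeasurable P _ h)]
          rfl
        · exact zero_le
    _ = ∑' n : ℕ, P {ω | (n : ℝ≥0∞) < f ω} := by
        rw [lintegral_tsum fun n => (measurable_one.indicator
          (measurableSet_toMeasurable _ _)).aemeasurable]
        refine tsum_congr fun n => ?_
        rw [lintegral_indicator_one (measurableSet_toMeasurable _ _), measure_toMeasurable]

/-- The term of order `2d` of the exponential series gives a bound by a multiple of `1/n²`. -/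
lemma summable_exp_neg_rpow {c : ℝ} (hc : 0 < c) {d : ℕ} (hd : d ≠ 0) :
    Summable fun n : ℕ => Real.exp (-c * (n : ℝ) ^ (1 / d : ℝ)) := by
  have hs : Summable fun n : ℕ =>
      ((Nat.factorial (2 * d) : ℝ) / c ^ (2 * d)) * (1 / (n : ℝ) ^ 2) :=
    (Real.summable_one_div_nat_pow.2 one_lt_two).mul_left _
  refine hs.of_norm_bounded_eventually_nat ?_
  filter_upwards [Filter.eventually_ge_atTop 1] with n hn
  have hn' : (0 : ℝ) < n := by exact_mod_cast hn
  set x := (n : ℝ) ^ (1 / d : ℝ) with hx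
  have hx0 : 0 < x := Real.rpow_pos_of_pos hn' _
  have hxd : x ^ (2 * d) = (n : ℝ) ^ 2 := by
    rw [mul_comm, pow_mul, hx, one_div, Real.rpow_inv_natCast_pow hn'.le hd]
  have h := Real.pow_div_factorial_le_exp (x := c * x) (by positivity) (2 * d)
  rw [Real.norm_of_nonneg (Real.exp_pos _).le, neg_mul, Real.exp_neg]
  calc (Real.exp (c * x))⁻¹ ≤ ((c * x) ^ (2 * d) / (Nat.factorial (2 * d) : ℝ))⁻¹ :=
        inv_anti₀ (by positivity) h
    _ = _ := by
        rw [mul_pow, hxd]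
        field_simp

lemma lintegral_lt_top_of_tail {Ω : Type*} [MeasurableSpace Ω] {P : Measure Ω}
    [IsProbabilityMeasure P] {f : Ω → ℝ≥0∞} {c C : ℝ} (hc : 0 < c) {d : ℕ} (hd : d ≠ 0)
    (h : ∀ n : ℕ, P.real {ω | (n : ℝ≥0∞) < f ω} ≤ C * Real.exp (-c * (n : ℝ) ^ (1 / d : ℝ))) :
    ∫⁻ ω, f ω ∂P < ∞ := by
  have hs := (summable_exp_neg_rpow hc hd).mul_left C
  refine ((lintegral_le_tsum_measure_lt P f).trans (ENNReal.tsum_le_tsum fun n => ?_)).trans_lt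
    (lt_top_iff_ne_top.2 hs.tsum_ofReal_ne_top)
  rw [← ofReal_measureReal]
  exact ENNReal.ofReal_le_ofReal (h n)

/-! ### Transfer to arbitrary environments -/

section

variable {Ω : Type*} [MeasurableSpace Ω] {P : Measure Ω} {U V : ℤ → Ω → ℤ}

/-- The environment in the canonical space given by families of signs. -/
def toCoinSpace (U V : ℤ → Ω → ℤ) (ω : Ω) : CoinSpace := fun i => decide (Sum.elim U V i ω = 1)

lemma IsManhattanEnvironment.horiz_toCoinSpace (h : IsManhattanEnvironment P U V) (ω : Ω) :
    (toCoinSpace U V ω).horiz = fun y => U y ω := by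
  ext y
  rcases h.horizontal_values y ω with h1 | h1 <;>
    simp [toCoinSpace, CoinSpace.horiz, boolSign, h1]

lemma IsManhattanEnvironment.vert_toCoinSpace (h : IsManhattanEnvironment P U V) (ω : Ω) :
    (toCoinSpace U V ω).vert = fun x => V x ω := by
  ext x
  rcases h.vertical_values x ω with h1 | h1 <;>
    simp [toCoinSpace, CoinSpace.vert, boolSign, h1]

lemma map_decide_eq_fairCoin [IsProbabilityMeasure P] {X : Ω → ℤ} (hX : Measurable X)
    (hval : ∀ ω, X ω = -1 ∨ X ω = 1) (hsymm : P {ω | X ω = -1} = P {ω | X ω = 1}) :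
    P.map (fun ω => decide (X ω = 1)) = fairCoin := by
  have hdec : Measurable fun z : ℤ => decide (z = 1) := measurable_of_countable _
  have hm : ∀ z : ℤ, MeasurableSet {ω | X ω = z} := fun z => hX (measurableSet_singleton z)
  have hsum : P {ω | X ω = 1} + P {ω | X ω = 1} = 1 := by
    nth_rw 1 [← hsymm]
    rw [← measure_union _ (hm 1), ← measure_univ (μ := P)]
    · congr 1
      ext ω
      simpa using hval ω
    · refine Set.disjoint_left.2 fun ω h1 h2 => ?_
      have h1' : X ω = -1 := h1
      have h2' : X ω = 1 := h2
      omega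
  have hhalf : P {ω | X ω = 1} = 2⁻¹ := by
    rw [← two_mul] at hsum
    exact ENNReal.eq_inv_of_mul_eq_one_left (by rwa [mul_comm])
  refine eq_fairCoin _ fun b => ?_
  rw [Measure.map_apply (f := fun ω => decide (X ω = 1)) (hdec.comp hX)
    (measurableSet_singleton b)]
  cases b
  · rw [← hhalf, ← hsymm]
    congr 1
    ext ω
    rcases hval ω with h | h <;> simp [h]
  · rw [← hhalf]
    congr 1
    ext ω
    simp

lemma IsManhattanEnvironment.measurable_elim (h : IsManhattanEnvironment P U V) (i : ℤ ⊕ ℤ) :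
    Measurable (Sum.elim U V i) := by
  rcases i with y | x
  · exact h.measurable_horizontal y
  · exact h.measurable_vertical x

lemma IsManhattanEnvironment.measurable_toCoinSpace (h : IsManhattanEnvironment P U V) :
    Measurable (toCoinSpace U V) :=
  measurable_pi_lambda _ fun i =>
    (measurable_of_countable fun z : ℤ => decide (z = 1)).comp (h.measurable_elim i)

lemma IsManhattanEnvironment.map_toCoinSpace [IsProbabilityMeasure P]
    (h : IsManhattanEnvironment P U V) : P.map (toCoinSpace U V) = coinMeasure := by
  have hdec : Measurable fun z : ℤ => decide (z = 1) := measurable_of_countable _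
  have hind := h.indep.comp (fun _ z => decide (z = 1)) fun _ => hdec
  have hmap := hind.map_fun_eq_infinitePi_map fun i => hdec.comp (h.measurable_elim i)
  refine hmap.trans ?_
  unfold coinMeasure
  congr 1
  ext1 i
  rcases i with y | x
  · exact map_decide_eq_fairCoin (h.measurable_horizontal y) (h.horizontal_values y)
      (h.horizontal_symm y)
  · exact map_decide_eq_fairCoin (h.measurable_vertical x) (h.vertical_values x)
      (h.vertical_symm x)

lemma IsManhattanEnvironment.measureReal_le [IsProbabilityMeasure P]
    (h : IsManhattanEnvironment P U V) {o : ℤ × ℤ} {q : ℕ} {A : Set Ω}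
    (hA : ∀ ω ∈ A, ∃ u ∈ manhattanComponent (fun y => U y ω) (fun x => V x ω) o,
      2 * q ^ 4 ≤ supDist u o) :
    P.real A ≤ tailConstant * Real.exp (-(q / 10)) := by
  have hpos : 0 ≤ tailConstant * Real.exp (-(q / 10 : ℝ)) :=
    mul_nonneg (zero_le_one.trans one_le_tailConstant) (Real.exp_pos _).le
  refine ENNReal.toReal_le_of_le_ofReal hpos ?_
  refine le_trans ?_ (coinMeasure_escapeSet_le_exp o q)
  rw [← h.map_toCoinSpace]
  refine le_trans (measure_mono fun ω hω => ?_)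
    (Measure.le_map_apply h.measurable_toCoinSpace.aemeasurable _)
  change ∃ u ∈ manhattanComponent (toCoinSpace U V ω).horiz (toCoinSpace U V ω).vert o, _
  rw [h.horiz_toCoinSpace, h.vert_toCoinSpace]
  exact hA ω hω

lemma IsManhattanEnvironment.le_measureReal [IsProbabilityMeasure P]
    (h : IsManhattanEnvironment P U V) {o : ℤ × ℤ} {n : ℕ} {A : Set Ω}
    (hA : ∀ ω, (∀ t ≤ n + 1, U (manhattanWalk (fun y => U y ω) (fun x => V x ω) o t).2 ω = 1) →
      ω ∈ A) :
    Real.exp (-9) * Real.exp (-6 * (n : ℝ) ^ (1 / 3 : ℝ)) ≤ P.real A := by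
  rw [measureReal_def, ← ENNReal.ofReal_le_iff_le_toReal (measure_ne_top P A)]
  refine (coinMeasure_straightSet_ge_exp o n).trans ?_
  rw [← h.map_toCoinSpace,
    Measure.map_apply h.measurable_toCoinSpace (measurableSet_straightSet o (n + 1))]
  refine measure_mono fun ω hω => hA ω fun t ht => ?_
  have := hω t ht
  rwa [h.horiz_toCoinSpace, h.vert_toCoinSpace] at this

/-- Stated for any set between lineage and component, so that both cases share their constants. -/
lemma IsManhattanEnvironment.hasSizeTails [IsProbabilityMeasure P]
    (h : IsManhattanEnvironment P U V) {o : ℤ × ℤ} {C : Ω → Set (ℤ × ℤ)}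
    (hl : ∀ ω, manhattanLineage (fun y => U y ω) (fun x => V x ω) o ⊆ C ω)
    (hu : ∀ ω, C ω ⊆ manhattanComponent (fun y => U y ω) (fun x => V x ω) o) :
    HasSizeTails P C 6 (Real.exp (-9)) (1 / 20) (tailConstant * Real.exp (1 / 10)) := by
  have hfar : ∀ (m : ℕ) ω, (∀ u ∈ C ω, ¬ m ≤ supDist u o) → ∀ u ∈ C ω, supDist u o ≤ m :=
    fun m ω h u hu => (not_le.1 (h u hu)).le
  have hdiam : ∀ n : ℕ, P.real {ω | (n : ℝ≥0∞) < latticeDiam (C ω)} ≤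
      tailConstant * Real.exp (1 / 10) * Real.exp (-(1 / 20) * (n : ℝ) ^ (1 / (4 : ℕ) : ℝ)) := by
    intro n
    -- Radius `2q^4` bounds the diameter by `6q^4`.
    obtain ⟨q, hq, hq'⟩ := exists_mul_pow_le_lt (K := 6) (d := 4) (by norm_num) (by norm_num) n
    refine (h.measureReal_le (o := o) fun ω hω => ?_).trans
      (tail_exp_le (by norm_num) (by norm_num) hq')
    by_contra! hc
    have h1 := latticeDiam_le_of_supDist_le (hfar _ ω fun u hu' => not_le.2 (hc u (hu ω hu')))
    refine absurd (lt_of_lt_of_le hω h1) (not_lt.2 ?_)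
    exact_mod_cast (by omega : 3 * (2 * q ^ 4) ≤ n)
  have hcard : ∀ n : ℕ, P.real {ω | (n : ℝ≥0∞) < latticeCard (C ω)} ≤
      tailConstant * Real.exp (1 / 10) * Real.exp (-(1 / 20) * (n : ℝ) ^ (1 / (8 : ℕ) : ℝ)) := by
    intro n
    obtain ⟨q, hq, hq'⟩ := exists_mul_pow_le_lt (K := 25) (d := 8) (by norm_num) (by norm_num) n
    refine le_trans ?_ (tail_exp_le (by norm_num) (by norm_num) hq')
    -- For `q = 0` the box still has one point, so `(4q^4 + 1)² ≤ 25q^8` fails; the bound is then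
    -- trivial because the constant is at least 1.
    rcases Nat.eq_zero_or_pos q with rfl | hq1
    · refine measureReal_le_one.trans ?_
      simpa using one_le_tailConstant
    refine h.measureReal_le (o := o) fun ω hω => ?_
    by_contra! hc
    have h1 := latticeCard_le_of_supDist_le (hfar _ ω fun u hu' => not_le.2 (hc u (hu ω hu')))
    refine absurd (lt_of_lt_of_le hω h1) (not_lt.2 ?_)
    have h2 : (2 * (2 * q ^ 4) + 1) ^ 2 ≤ n := by
      have h3 : 1 ≤ q ^ 4 := Nat.one_le_pow _ _ hq1
      calc (2 * (2 * q ^ 4) + 1) ^ 2 ≤ (5 * q ^ 4) ^ 2 := Nat.pow_le_pow_left (by omega) 2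
        _ = 25 * q ^ 8 := by ring
        _ ≤ n := hq
    exact_mod_cast h2
  refine ⟨fun n => ⟨?_, ?_⟩, fun n => ⟨?_, ?_⟩, ?_, ?_⟩
  · exact h.le_measureReal (o := o) fun ω hω => (lt_latticeDiam_lineage_of_straight
      (U := fun y => U y ω) hω).trans_le (latticeDiam_mono (hl ω))
  · exact_mod_cast hdiam n
  · exact h.le_measureReal (o := o) fun ω hω => (lt_latticeCard_lineage_of_straight
      (U := fun y => U y ω) hω).trans_le (latticeCard_mono (hl ω))
  · exact_mod_cast hcard n
  · exact lintegral_lt_top_of_tail (by norm_num) (by norm_num) hdiam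
  · exact lintegral_lt_top_of_tail (by norm_num) (by norm_num) hcard

end

theorem mainTheorem8 :
    ∃ c₁ C₁ c₂ C₂ : ℝ, 0 < c₁ ∧ 0 < C₁ ∧ 0 < c₂ ∧ 0 < C₂ ∧
      ∀ (Ω : Type*) [MeasurableSpace Ω] (P : Measure Ω) [IsProbabilityMeasure P]
        (U V : ℤ → Ω → ℤ), IsManhattanEnvironment P U V → ∀ o : ℤ × ℤ,
        HasSizeTails P (fun ω => manhattanComponent (fun y => U y ω) (fun x => V x ω) o)
          c₁ C₁ c₂ C₂ ∧
        HasSizeTails P (fun ω => manhattanLineage (fun y => U y ω) (fun x => V x ω) o)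
          c₁ C₁ c₂ C₂ := by
  refine ⟨6, Real.exp (-9), 1 / 20, tailConstant * Real.exp (1 / 10), by norm_num, Real.exp_pos _,
    by norm_num, mul_pos (zero_lt_one.trans_le one_le_tailConstant) (Real.exp_pos _), ?_⟩
  intro Ω _ P _ U V h o
  have hsub : ∀ ω, manhattanLineage (fun y => U y ω) (fun x => V x ω) o ⊆
      manhattanComponent (fun y => U y ω) (fun x => V x ω) o := fun ω =>
    manhattanLineage_subset_component fun y => (h.horizontal_values y ω).symm
  exact ⟨h.hasSizeTails hsub fun ω => subset_rfl, h.hasSizeTails (fun ω => subset_rfl) hsub⟩
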